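/- **Theorem 3.** Let $\mathcal S$ be a finite set, $\nu$ a $\sigma$-finite measure on a measurable space $\mathcal Z$, and $f(\cdot|x)$, $x\in\mathcal S$, and $f(\cdot|\theta_0)$ probability densities with respect to $\nu$. Let $\pi$ be a probability vector on $\mathcal S$ and $a(x,y)$ the transition probability from $x$ to $y$. Under $H_0$ the observations $Z_1,Z_2,\ldots$ are i.i.d. with density $f(\cdot|\theta_0)$. Under $H_1$, $\{(X_k,Z_k)\}_{k\ge1}$ is a hidden Markov model: $\{X_k\}$ is a Markov chain with initial distribution $\pi$ and transition probabilities $a$ and, given $\{X_k\}$, the $Z_k$ are independent with densities $f(\cdot|X_k)$. Let $$\Lambda_k=\sum_{x_{1:k}\in\mathcal S^k}\pi(x_1)\prod_{i=2}^k a(x_{i-1},x_i)\;\frac{\prod_{i=1}^k f(Z_i|x_i)}{\prod_{i=1}^k f(Z_i|\theta_0)}.$$ Suppose that 1. the Markov chain $\{X_k\}$ is stationary, irreducible and aperiodic; 2. for no probability vector $c$ on $\mathcal S$ is $\sum_{x\in\mathcal S}c(x)f(\cdot|x)$ equal to $f(\cdot|\theta_0)$ $\nu$-a.e.; 3. $\operatorname{E}_{H_i}\big[\,\big|\ln\frac{f(Z_1|x)}{f(Z_1|\theta_0)}\big|\,\big]<+\infty$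 for every $x\in\mathcal S$ and $i=0,1$. Then the limits $\lambda_i=\lim_{k\to\infty}k^{-1}\operatorname{E}_{H_i}[\ln\Lambda_k]$, $i=0,1$, exist and are finite, with $\lambda_0<0<\lambda_1$, and the following holds. For all $\alpha',\beta'\in(0,1)$ let boundaries $0<\gamma_0<1<\gamma_1<+\infty$, which may depend on $(\alpha',\beta')$, be such that the sequential probability ratio test that stops at $\tau=\inf\{k\ge1:\Lambda_k\notin(\gamma_0,\gamma_1)\}$ and accepts $H_1$ if $\Lambda_\tau\ge\gamma_1$ and $H_0$ if $\Lambda_\tau\le\gamma_0$ has error probabilities of the first and second kind at most $\alpha'$ and $\beta'$, respectively. Then, for every real $r>0$, $$\liminf_{\alpha'+\beta'\to0}\frac{\operatorname{E}_{H_0}[\tau^r]}{|\ln\beta'|^r}\ge\frac1{|\lambda_0|^r}\qquad\text{and}\qquad\liminf_{\alpha'+\beta'\to0}\frac{\operatorname{E}_{H_1}[\tau^r]}{|\ln\alpha'|^r}\ge\frac1{\lambda_1^r}.$$ -/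

import Mathlib

open MeasureTheory ProbabilityTheory Filter Topology Set
open scoped ENNReal

/-- The data of the detection problem: a Markov chain on `S` with initial distribution `init` and
transition probabilities `trans x y` (from `x` to `y`), the density `f x` of an observation given
the state `x`, and the density `f₀` of an observation when there is only noise, all the densities
being taken with respect to `ν`. -/
structure HMMModel (S 𝒵 : Type*) [Fintype S] [MeasurableSpace 𝒵] (ν : Measure 𝒵) where
  init : PMF S
  trans : S → PMF S
  f : S → 𝒵 → ℝ≥0∞
  f₀ : 𝒵 → ℝ≥0∞
  measurable_f : ∀ x, Measurable (f x)
  measurable_f₀ : Measurable f₀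
  lintegral_f : ∀ x, ∫⁻ z, f x z ∂ν = 1
  lintegral_f₀ : ∫⁻ z, f₀ z ∂ν = 1

/-- The observations `Z₁, …, Z_k`; the process is indexed from `0`, so that `Z i` is the
observation at time `i + 1`. -/
def obs {Ω 𝒵 : Type*} (Z : ℕ → Ω → 𝒵) (k : ℕ) (ω : Ω) : Fin k → 𝒵 := fun i => Z i ω

/-- A non-randomized sequential test: after `k ≥ 1` observations `z`, sampling stops if
`z ∈ stopSet k`, and then `H₁` is accepted if `z ∈ acceptSet k` and `H₀` is accepted otherwise. -/
structure SeqTest (𝒵 : Type*) [MeasurableSpace 𝒵] where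
  stopSet : ∀ k : ℕ, Set (Fin k → 𝒵)
  acceptSet : ∀ k : ℕ, Set (Fin k → 𝒵)
  measurableSet_stopSet : ∀ k, MeasurableSet (stopSet k)
  measurableSet_acceptSet : ∀ k, MeasurableSet (acceptSet k)

namespace SeqTest

variable {𝒵 Ω : Type*} [MeasurableSpace 𝒵] [MeasurableSpace Ω]

/-- The stopping time of a test (`⊤` if the test never stops). -/
noncomputable def time (T : SeqTest 𝒵) (Z : ℕ → Ω → 𝒵) (ω : Ω) : ℕ∞ :=
  ⨅ (k : ℕ) (_ : 1 ≤ k ∧ obs Z k ω ∈ T.stopSet k), (k : ℕ∞)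

/-- Probability of an error of the first kind: the test stops and accepts `H₁`, under `P₀`. -/
noncomputable def errorI (T : SeqTest 𝒵) (Z : ℕ → Ω → 𝒵) (P₀ : Measure Ω) : ℝ≥0∞ :=
  P₀ {ω | ∃ k : ℕ, T.time Z ω = k ∧ obs Z k ω ∈ T.acceptSet k}

/-- Probability of an error of the second kind: the test stops and accepts `H₀`, under `P₁`. -/
noncomputable def errorII (T : SeqTest 𝒵) (Z : ℕ → Ω → 𝒵) (P₁ : Measure Ω) : ℝ≥0∞ :=
  P₁ {ω | ∃ k : ℕ, T.time Z ω = k ∧ obs Z k ω ∉ T.acceptSet k}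

/-- `r`-th moment of the stopping time of a test. -/
noncomputable def moment (T : SeqTest 𝒵) (Z : ℕ → Ω → 𝒵) (P : Measure Ω) (r : ℝ) : ℝ≥0∞ :=
  ∫⁻ ω, ((T.time Z ω : ℕ∞) : ℝ≥0∞) ^ r ∂P

end SeqTest

/-- The class of the non-randomized tests whose error probabilities of the first and of the second
kind are at most `α` and `β`. -/
def testClass {𝒵 Ω : Type*} [MeasurableSpace 𝒵] [MeasurableSpace Ω] (Z : ℕ → Ω → 𝒵)
    (P₀ P₁ : Measure Ω) (α β : ℝ) : Set (SeqTest 𝒵) :=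
  {T | T.errorI Z P₀ ≤ ENNReal.ofReal α ∧ T.errorII Z P₁ ≤ ENNReal.ofReal β}

namespace HMMModel

variable {S 𝒵 Ω : Type*} [Fintype S] [MeasurableSpace 𝒵] [MeasurableSpace Ω] {ν : Measure 𝒵}

/-- The probability of the trajectory `x₁, …, x_k`. -/
noncomputable def pathProb (m : HMMModel S 𝒵 ν) : (k : ℕ) → (Fin k → S) → ℝ≥0∞
  | 0, _ => 1
  | k + 1, x => m.init (x 0) * ∏ i : Fin k, m.trans (x i.castSucc) (x i.succ)

/-- The density of `k` observations given the trajectory `x`. -/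
noncomputable def condDensity (m : HMMModel S 𝒵 ν) {k : ℕ} (x : Fin k → S) (z : Fin k → 𝒵) :
    ℝ≥0∞ :=
  ∏ i, m.f (x i) (z i)

/-- The density of `k` observations when there is only noise. -/
noncomputable def noiseDensity (m : HMMModel S 𝒵 ν) {k : ℕ} (z : Fin k → 𝒵) : ℝ≥0∞ :=
  ∏ i, m.f₀ (z i)

open Classical in
/-- The likelihood ratio of `k` observations: the mean, over the trajectories, of the likelihood
ratios given the trajectory. -/
noncomputable def likelihoodRatio (m : HMMModel S 𝒵 ν) {k : ℕ} (z : Fin k → 𝒵) : ℝ≥0∞ :=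
  ∑ x : Fin k → S, m.pathProb k x * (m.condDensity x z / m.noiseDensity z)

theorem measurable_likelihoodRatio (m : HMMModel S 𝒵 ν) (k : ℕ) :
    Measurable (fun z : Fin k → 𝒵 => m.likelihoodRatio z) := by
  classical
  unfold likelihoodRatio condDensity noiseDensity
  refine Finset.measurable_sum _ fun x _ => Measurable.const_mul (Measurable.div ?_ ?_) _
  · exact Finset.measurable_prod _ fun i _ => (m.measurable_f (x i)).comp (measurable_pi_apply i)
  · exact Finset.measurable_prod _ fun i _ => m.measurable_f₀.comp (measurable_pi_apply i)

/-- The sequential probability ratio test with boundaries `γ₀` and `γ₁`. -/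
noncomputable def sprt (m : HMMModel S 𝒵 ν) (γ₀ γ₁ : ℝ) : SeqTest 𝒵 where
  stopSet _ := {z | m.likelihoodRatio z ∉ Ioo (ENNReal.ofReal γ₀) (ENNReal.ofReal γ₁)}
  acceptSet _ := {z | ENNReal.ofReal γ₁ ≤ m.likelihoodRatio z}
  measurableSet_stopSet k := (m.measurable_likelihoodRatio k measurableSet_Ioo).compl
  measurableSet_acceptSet k := m.measurable_likelihoodRatio k measurableSet_Ici

/-- Hypothesis `H₀` (noise only): under `P`, the observations are independent and identically
distributed with density `f₀`. -/
def IsNoise (m : HMMModel S 𝒵 ν) (P : Measure Ω) (Z : ℕ → Ω → 𝒵) : Prop :=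
  (∀ i, Measurable (Z i)) ∧ iIndepFun Z P ∧ ∀ i, P.map (Z i) = ν.withDensity m.f₀

/-- Hypothesis `H₁` (signal present): under `P`, `(X, Z)` is the hidden Markov model with the given
initial distribution, transition probabilities and observation densities. -/
def IsSignal [MeasurableSpace S] [SigmaFinite ν] (m : HMMModel S 𝒵 ν) (P : Measure Ω)
    (X : ℕ → Ω → S) (Z : ℕ → Ω → 𝒵) : Prop :=
  (∀ i, Measurable (X i)) ∧ (∀ i, Measurable (Z i)) ∧
    ∀ (k : ℕ) (x : Fin k → S) (A : Set (Fin k → 𝒵)), MeasurableSet A →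
      P {ω | obs X k ω = x ∧ obs Z k ω ∈ A} =
        m.pathProb k x * ∫⁻ z in A, m.condDensity x z ∂(Measure.pi fun _ : Fin k => ν)

open Classical in
/-- The `n`-step transition probability from `x` to `y`. -/
noncomputable def nStep (m : HMMModel S 𝒵 ν) (n : ℕ) (x y : S) : ℝ≥0∞ :=
  ((Matrix.of fun x y => m.trans x y : Matrix S S ℝ≥0∞) ^ n) x y

/-- The Markov chain is stationary, irreducible and aperiodic. -/
def StationaryErgodicChain (m : HMMModel S 𝒵 ν) : Prop :=
  (∀ y, ∑ x, m.init x * m.trans x y = m.init y) ∧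
    (∀ x y, ∃ n, 0 < m.nStep n x y) ∧
    ∀ (x : S) (d : ℕ), (∀ n, 1 ≤ n → 0 < m.nStep n x x → d ∣ n) → d = 1

/-- No mixture of the densities `f x` is equal to `f₀` almost everywhere. -/
def NoiseNotMixture (m : HMMModel S 𝒵 ν) : Prop :=
  ∀ c : PMF S, ¬ (fun z => ∑ x, c x * m.f x z) =ᵐ[ν] m.f₀

/-- For every state `x`, `ln (f x (Z₁) / f₀ (Z₁))` has a finite absolute first moment under `P`.
The logarithm takes values in `[-∞, ∞]` here, so that it must be finite almost surely. -/
def FiniteLogMoment (m : HMMModel S 𝒵 ν) (P : Measure Ω) (Z : ℕ → Ω → 𝒵) : Prop :=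
  ∀ x, ∫⁻ ω, (ENNReal.log (m.f x (Z 0 ω) / m.f₀ (Z 0 ω))).abs ∂P < ∞

/-- `l` is the limit of `k⁻¹ E[ln Λ_k(Z₁, …, Z_k)]`, the expectations being under `P`. -/
def IsLogLikelihoodRate (m : HMMModel S 𝒵 ν) (P : Measure Ω) (Z : ℕ → Ω → 𝒵) (l : ℝ) : Prop :=
  (∀ k, Integrable (fun ω => Real.log (m.likelihoodRatio (obs Z k ω)).toReal) P) ∧
    Tendsto (fun k : ℕ => (∫ ω, Real.log (m.likelihoodRatio (obs Z k ω)).toReal ∂P) / (k : ℝ))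
      atTop (𝓝 l)

end HMMModel

/-- `α + β → 0`, where `α` and `β` range over `(0, 1)`. -/
def errorBoundsToZero : Filter (ℝ × ℝ) :=
  comap (fun p => p.1 + p.2) (𝓝 0) ⊓ 𝓟 (Ioo 0 1 ×ˢ Ioo 0 1)

/-! Write `Λ_n` for the likelihood ratio of `n` observations. Three facts carry the proof: `n⁻¹ ln
Λ_n` converges in `L¹` to a constant under each hypothesis, the two constants have the stated signs,
and a change of measure over the first `n` observations makes early stopping unlikely.

Convergence. A stationary irreducible chain charges every state, so conditioning the signal model on
its state at time `n` costs at most a constant factor `C`, and `ln Λ_n + ln C` is subadditive along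
the observations (`logLR_add_le`). Fekete's lemma gives the limit of the means. Averaging the
subadditive inequality over the positions of a window of fixed length bounds the positive part of
the deviation by an ergodic average, and the mean then controls the absolute deviation
(`exists_tendsto_of_subadditive`). The ergodic averages come from an `L¹` law of large numbers for
windows of a stationary Markov chain whose Poisson equation is solvable. For the pair (state,
observation) that equation reduces to a linear system on the finite state space; i.i.d. noise is the
case of one state.

Signs. By compactness of the simplex, the Hellinger affinity of the noise density and of any mixture
of the signal densities is at most some `ρ < 1`. Given the past, the next observation contributes
such a mixture, so `E₀[√Λ_n] ≤ ρ ^ n`; moreover `E₁[1/√Λ_n] = E₀[√Λ_n]`. Jensen's inequality turns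
both into `λ₀ ≤ 2 ln ρ < 0 < -2 ln ρ ≤ λ₁`.

Lower bound. Let a test have error probabilities at most `α` and `β`. Under `P₀`, stopping by time
`n` means accepting `H₁`, which has probability at most `α`, or accepting `H₀`, which has
probability at most `β` under `P₁`. Moving the latter event to `P₀` costs a factor `e^{sn}` unless
`ln Λ_n < -sn`, which is unlikely for `s > |λ₀|`. For `n` about `|ln β| / t` with `t > s` the total
tends to zero, so `τ > n` with probability tending to one and the moment bound follows; then `t`
decreases to `|λ₀|`. The other hypothesis is symmetric. -/

/-- The averages of the first `n` terms of `ξ` tend to the constant `c` in `L¹`. -/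
def TendstoAverage {Ω : Type*} [MeasurableSpace Ω] (P : Measure Ω) (ξ : ℕ → Ω → ℝ) (c : ℝ) : Prop :=
  Tendsto (fun n : ℕ => ∫ ω, |(∑ i ∈ Finset.range n, ξ i ω) / (n : ℝ) - c| ∂P) atTop (𝓝 0)

/-! ### Averages that converge in `L¹` to a constant -/

section Averages

variable {Ω : Type*} [MeasurableSpace Ω] {P : Measure Ω}

theorem TendstoAverage.of_const (c : ℝ) : TendstoAverage P (fun _ _ => c) c := by
  refine tendsto_const_nhds.congr' ((eventually_gt_atTop 0).mono fun n hn => ?_)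
  have hn' : (n : ℝ) ≠ 0 := Nat.cast_ne_zero.2 hn.ne'
  simp [hn']

theorem TendstoAverage.congr {ξ η : ℕ → Ω → ℝ} {c d : ℝ} (h : TendstoAverage P ξ c)
    (hξη : ∀ i, ξ i =ᵐ[P] η i) (hcd : c = d) : TendstoAverage P η d := by
  subst hcd
  refine Tendsto.congr (fun n => integral_congr_ae ?_) h
  filter_upwards [ae_all_iff.2 hξη] with ω hω
  simp [hω]

variable [IsProbabilityMeasure P]

theorem integrable_average {ξ : ℕ → Ω → ℝ} (hξ : ∀ i, Integrable (ξ i) P) (c : ℝ) (n : ℕ) :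
    Integrable (fun ω => (∑ i ∈ Finset.range n, ξ i ω) / (n : ℝ) - c) P :=
  ((integrable_finsetSum _ fun i _ => hξ i).div_const _).sub (integrable_const c)

theorem TendstoAverage.add {ξ η : ℕ → Ω → ℝ} {c d : ℝ} (hξ : ∀ i, Integrable (ξ i) P)
    (hη : ∀ i, Integrable (η i) P) (h₁ : TendstoAverage P ξ c) (h₂ : TendstoAverage P η d) :
    TendstoAverage P (fun i ω => ξ i ω + η i ω) (c + d) := by
  have h := Tendsto.add h₁ h₂
  rw [add_zero] at h
  refine squeeze_zero (fun n => integral_nonneg fun ω => abs_nonneg _) (fun n => ?_) h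
  have i₁ := (integrable_average hξ c n).abs
  have i₂ := (integrable_average hη d n).abs
  rw [← integral_add i₁ i₂]
  refine integral_mono_of_nonneg (ae_of_all _ fun ω => abs_nonneg _) (i₁.add i₂)
    (ae_of_all _ fun ω => ?_)
  simp only [Finset.sum_add_distrib]
  refine le_trans (le_of_eq ?_) (abs_add_le _ _)
  congr 1
  ring

/-- Orthogonality removes the cross terms, so the squared sum has mean at most `n B²`. The
inequality `2 |s| √n ≤ s² + n` passes from the second moment to the first and gives the rate
`n^{-1/2}`. -/
theorem TendstoAverage.of_orthogonal {D : ℕ → Ω → ℝ} {B : ℝ} (hm : ∀ i, Measurable (D i))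
    (hB : ∀ i ω, |D i ω| ≤ B) (ho : ∀ i j, i < j → ∫ ω, D i ω * D j ω ∂P = 0) :
    TendstoAverage P D 0 := by
  have hi : ∀ i, Integrable (D i) P := fun i =>
    Integrable.of_bound (hm i).aestronglyMeasurable B (ae_of_all _ fun ω => by simpa using hB i ω)
  have hij : ∀ i j, Integrable (fun ω => D i ω * D j ω) P := fun i j =>
    Integrable.of_bound ((hm i).mul (hm j)).aestronglyMeasurable (B * B) (ae_of_all _ fun ω => by
      rw [Real.norm_eq_abs, abs_mul]
      exact mul_le_mul (hB i ω) (hB j ω) (abs_nonneg _) ((abs_nonneg _).trans (hB i ω)))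
  have hsq : ∀ n : ℕ, ∫ ω, (∑ i ∈ Finset.range n, D i ω) ^ 2 ∂P ≤ n * B ^ 2 := by
    intro n
    have e : ∀ ω, (∑ i ∈ Finset.range n, D i ω) ^ 2 =
        ∑ i ∈ Finset.range n, ∑ j ∈ Finset.range n, D i ω * D j ω := fun ω => by
      rw [sq, Finset.sum_mul_sum]
    simp_rw [e]
    rw [integral_finsetSum _ fun i _ => integrable_finsetSum _ fun j _ => hij i j]
    have : ∀ i ∈ Finset.range n, ∫ ω, ∑ j ∈ Finset.range n, D i ω * D j ω ∂P ≤ B ^ 2 := by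
      intro i hin
      rw [integral_finsetSum _ fun j _ => hij i j, Finset.sum_eq_single_of_mem i hin]
      · calc ∫ ω, D i ω * D i ω ∂P ≤ ∫ _, B ^ 2 ∂P := by
              refine integral_mono (hij i i) (integrable_const _) fun ω => ?_
              simp only
              rw [← sq, ← sq_abs]
              exact pow_le_pow_left₀ (abs_nonneg _) (hB i ω) 2
          _ = B ^ 2 := by simp
      · intro j _ hj
        rcases lt_or_gt_of_ne hj with h | h
        · rw [← ho j i h]
          exact integral_congr_ae (ae_of_all _ fun ω => mul_comm _ _)
        · exact ho i j h
    calc _ ≤ ∑ i ∈ Finset.range n, B ^ 2 := Finset.sum_le_sum this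
      _ = n * B ^ 2 := by simp
  have hsqi : ∀ n : ℕ, Integrable (fun ω => (∑ i ∈ Finset.range n, D i ω) ^ 2) P := by
    intro n
    simp_rw [sq, Finset.sum_mul_sum]
    exact integrable_finsetSum _ fun i _ => integrable_finsetSum _ fun j _ => hij i j
  have hbound : ∀ n : ℕ, 0 < n → ∫ ω, |(∑ i ∈ Finset.range n, D i ω) / (n : ℝ) - 0| ∂P ≤
      (B ^ 2 + 1) / 2 / Real.sqrt n := by
    intro n hn
    have hn' : (0 : ℝ) < n := Nat.cast_pos.2 hn
    have hs : 0 < Real.sqrt n := Real.sqrt_pos.2 hn'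
    have hss : Real.sqrt n * Real.sqrt n = n := Real.mul_self_sqrt hn'.le
    calc _ ≤ ∫ ω, ((∑ i ∈ Finset.range n, D i ω) ^ 2 / (n * Real.sqrt n) + 1 / Real.sqrt n) / 2 ∂P := by
          refine integral_mono (integrable_average hi 0 n).abs
            ((((hsqi n).div_const _).add (integrable_const _)).div_const 2) fun ω => ?_
          set s := ∑ i ∈ Finset.range n, D i ω
          simp only
          rw [sub_zero, abs_div, abs_of_pos hn', div_add_div _ _ (by positivity) hs.ne', div_div,
            div_le_div_iff₀ hn' (by positivity)]
          have key : 2 * |s| * Real.sqrt n ≤ s ^ 2 + n := by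
            nlinarith [sq_nonneg (|s| - Real.sqrt n), sq_abs s]
          have : s ^ 2 * √n + n * √n * 1 = (s ^ 2 + n) * √n := by ring
          rw [this, ← hss]
          rw [← hss] at key
          have := mul_le_mul_of_nonneg_right key (by positivity : 0 ≤ √n * (√n * √n))
          rw [hss] at *
          nlinarith
      _ = ((∫ ω, (∑ i ∈ Finset.range n, D i ω) ^ 2 ∂P) / (n * Real.sqrt n) + 1 / Real.sqrt n) / 2 := by
          rw [integral_div, integral_add ((hsqi n).div_const _) (integrable_const _), integral_div]
          simp
      _ ≤ (n * B ^ 2 / (n * Real.sqrt n) + 1 / Real.sqrt n) / 2 := by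
          gcongr
          exact hsq n
      _ = _ := by field_simp
  have hlim : Tendsto (fun n : ℕ => (B ^ 2 + 1) / 2 / Real.sqrt n) atTop (𝓝 0) :=
    tendsto_const_nhds.div_atTop (Real.tendsto_sqrt_atTop.comp tendsto_natCast_atTop_atTop)
  exact squeeze_zero' (Eventually.of_forall fun n => integral_nonneg fun ω => abs_nonneg _)
    ((eventually_gt_atTop 0).mono hbound) hlim

/-- The sum collapses to its two boundary terms, which are bounded. -/
theorem TendstoAverage.of_telescope {G : ℕ → Ω → ℝ} {B : ℝ} (hB : ∀ i ω, |G i ω| ≤ B) :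
    TendstoAverage P (fun i ω => G i ω - G (i + 1) ω) 0 := by
  have hlim : Tendsto (fun n : ℕ => (2 * B) / (n : ℝ)) atTop (𝓝 0) :=
    tendsto_const_nhds.div_atTop tendsto_natCast_atTop_atTop
  refine squeeze_zero (fun n => integral_nonneg fun ω => abs_nonneg _) (fun n => ?_) hlim
  refine (integral_mono_of_nonneg (ae_of_all _ fun ω => abs_nonneg _)
    (integrable_const (2 * B / (n : ℝ))) (ae_of_all _ fun ω => ?_)).trans (by simp)
  simp only [Finset.sum_range_sub', sub_zero, abs_div, Nat.abs_cast]
  gcongr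
  refine (abs_sub _ _).trans ?_
  linarith [hB 0 ω, hB n ω]

/-- The limit of the averages of identically distributed terms is their mean. -/
theorem TendstoAverage.eq_mean {ξ : ℕ → Ω → ℝ} {c m : ℝ} (h : TendstoAverage P ξ c)
    (hξ : ∀ i, Integrable (ξ i) P) (hm : ∀ i, ∫ ω, ξ i ω ∂P = m) : c = m := by
  have h0 : Tendsto (fun _ : ℕ => |m - c|) atTop (𝓝 0) := by
    refine squeeze_zero' (Eventually.of_forall fun _ => abs_nonneg _)
      ((eventually_gt_atTop 0).mono fun n hn => ?_) h
    have hn' : (n : ℝ) ≠ 0 := Nat.cast_ne_zero.2 hn.ne'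
    refine le_trans (le_of_eq ?_) (abs_integral_le_integral_abs (μ := P))
    rw [integral_sub ((integrable_finsetSum _ fun i _ => hξ i).div_const _) (integrable_const c),
      integral_div, integral_finsetSum _ fun i _ => hξ i]
    simp [hm, hn']
  have := tendsto_nhds_unique h0 tendsto_const_nhds
  linarith [abs_eq_zero.1 this.symm]

/-- The averages may be approximated uniformly in `L¹`. -/
theorem TendstoAverage.of_approx {ξ : ℕ → Ω → ℝ} {c : ℝ} (hξ : ∀ i, Integrable (ξ i) P)
    (h : ∀ ε > 0, ∃ (η : ℕ → Ω → ℝ) (d : ℝ), (∀ i, Integrable (η i) P) ∧ TendstoAverage P η d ∧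
      |d - c| ≤ ε ∧ ∀ i, ∫ ω, |ξ i ω - η i ω| ∂P ≤ ε) : TendstoAverage P ξ c := by
  rw [TendstoAverage, Metric.tendsto_atTop]
  intro ε hε
  obtain ⟨η, d, hη, hd, hdc, hle⟩ := h (ε / 4) (by positivity)
  obtain ⟨N, hN⟩ := Metric.tendsto_atTop.1 hd (ε / 4) (by positivity)
  refine ⟨N + 1, fun n hn => ?_⟩
  have hn0 : (0 : ℝ) < n := Nat.cast_pos.2 (by omega)
  have h1 := hN n (by omega)
  rw [Real.dist_0_eq_abs, abs_of_nonneg (integral_nonneg fun ω => abs_nonneg _)] at h1 ⊢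
  have i0 : ∀ i, Integrable (fun ω => |ξ i ω - η i ω|) P := fun i => ((hξ i).sub (hη i)).abs
  have i1 : Integrable (fun ω => (∑ i ∈ Finset.range n, |ξ i ω - η i ω|) / (n : ℝ)) P :=
    (integrable_finsetSum _ fun i _ => i0 i).div_const _
  have i2 := (integrable_average hη d n).abs
  have i12 : Integrable (fun ω => (∑ i ∈ Finset.range n, |ξ i ω - η i ω|) / (n : ℝ) +
      |(∑ i ∈ Finset.range n, η i ω) / (n : ℝ) - d|) P := i1.add i2
  calc ∫ ω, |(∑ i ∈ Finset.range n, ξ i ω) / (n : ℝ) - c| ∂P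
      ≤ ∫ ω, ((∑ i ∈ Finset.range n, |ξ i ω - η i ω|) / (n : ℝ) +
          |(∑ i ∈ Finset.range n, η i ω) / (n : ℝ) - d| + |d - c|) ∂P := by
        refine integral_mono (integrable_average hξ c n).abs
          (i12.add (integrable_const _)) fun ω => ?_
        have e : (∑ i ∈ Finset.range n, ξ i ω) / (n : ℝ) - c =
          (∑ i ∈ Finset.range n, (ξ i ω - η i ω)) / (n : ℝ) +
            ((∑ i ∈ Finset.range n, η i ω) / (n : ℝ) - d) + (d - c) := by
          rw [Finset.sum_sub_distrib]; ring
        simp only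
        rw [e]
        refine (abs_add_three _ _ _).trans ?_
        gcongr
        rw [abs_div, Nat.abs_cast]
        gcongr
        exact Finset.abs_sum_le_sum_abs _ _
    _ = (∑ i ∈ Finset.range n, ∫ ω, |ξ i ω - η i ω| ∂P) / (n : ℝ) +
          ∫ ω, |(∑ i ∈ Finset.range n, η i ω) / (n : ℝ) - d| ∂P + |d - c| := by
        rw [integral_add i12 (integrable_const _), integral_add i1 i2, integral_div,
          integral_finsetSum _ fun i _ => i0 i]
        simp
    _ ≤ ε / 4 + ε / 4 + ε / 4 := by
        refine add_le_add (add_le_add ?_ h1.le) hdc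
        rw [div_le_iff₀ hn0]
        calc _ ≤ ∑ i ∈ Finset.range n, ε / 4 := Finset.sum_le_sum fun i _ => hle i
          _ = _ := by simp [mul_comm]
    _ < ε := by linarith

end Averages

/-! ### Law of large numbers for Markov chains with a solvable Poisson equation -/

/-- `Y` is a Markov chain with transition kernel `K`. -/
structure IsMarkovChain {Ω E : Type*} [MeasurableSpace Ω] [MeasurableSpace E] (P : Measure Ω)
    (K : Kernel E E) (Y : ℕ → Ω → E) : Prop where
  measurable : ∀ i, Measurable (Y i)
  map_eq : ∀ k, P.map (fun ω => (obs Y (k + 1) ω, Y (k + 1) ω)) =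
    (P.map (obs Y (k + 1))) ⊗ₘ
      (K.comap (fun v : Fin (k + 1) → E => v (Fin.last k)) (measurable_pi_apply _))

/-- The Poisson equation of the kernel `K` has a bounded solution for every bounded function. -/
def HasPoissonSolutions {E : Type*} [MeasurableSpace E] (K : Kernel E E) : Prop :=
  ∀ h : E → ℝ, Measurable h → (∃ B, ∀ e, |h e| ≤ B) →
    ∃ (G : E → ℝ) (c : ℝ), Measurable G ∧ (∃ B, ∀ e, |G e| ≤ B) ∧
      ∀ e, G e - ∫ e', G e' ∂(K e) = h e - c

theorem measurable_obs {Ω E : Type*} [MeasurableSpace Ω] [MeasurableSpace E] {Y : ℕ → Ω → E}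
    (hY : ∀ i, Measurable (Y i)) (k : ℕ) : Measurable (obs Y k) :=
  measurable_pi_lambda _ fun i => hY i

theorem obs_succ {Ω E : Type*} (Y : ℕ → Ω → E) (k : ℕ) (ω : Ω) :
    obs Y (k + 1) ω = Fin.snoc (α := fun _ => E) (obs Y k ω) (Y k ω) := by
  funext i
  refine Fin.lastCases ?_ (fun j => ?_) i <;> simp [obs]

theorem measurable_snoc {E : Type*} [MeasurableSpace E] (n : ℕ) :
    Measurable (fun p : (Fin n → E) × E => Fin.snoc (α := fun _ => E) p.1 p.2) := by
  refine measurable_pi_lambda _ fun i => ?_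
  refine Fin.lastCases ?_ (fun j => ?_) i
  · simpa using measurable_snd
  · simpa [Function.comp_def] using (measurable_pi_apply j).comp measurable_fst

namespace IsMarkovChain

variable {Ω E : Type*} [MeasurableSpace Ω] [MeasurableSpace E] {P : Measure Ω}
  [IsProbabilityMeasure P] {K : Kernel E E} [IsMarkovKernel K] {Y : ℕ → Ω → E}

theorem lintegral_step (hY : IsMarkovChain P K Y) (k : ℕ) {F : (Fin (k + 1) → E) × E → ℝ≥0∞}
    (hF : Measurable F) :
    ∫⁻ ω, F (obs Y (k + 1) ω, Y (k + 1) ω) ∂P =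
      ∫⁻ ω, ∫⁻ e, F (obs Y (k + 1) ω, e) ∂(K (Y k ω)) ∂P := by
  have hm := measurable_obs hY.measurable (k + 1)
  rw [← lintegral_map (f := F) (g := fun ω => (obs Y (k + 1) ω, Y (k + 1) ω)) hF
    (hm.prodMk (hY.measurable _)), hY.map_eq, Measure.lintegral_compProd hF, lintegral_map _ hm]
  · rfl
  · exact hF.lintegral_kernel_prod_right'

theorem integral_step (hY : IsMarkovChain P K Y) (k : ℕ) {F : (Fin (k + 1) → E) × E → ℝ}
    (hF : Measurable F) {B : ℝ} (hB : ∀ x, |F x| ≤ B) :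
    ∫ ω, F (obs Y (k + 1) ω, Y (k + 1) ω) ∂P =
      ∫ ω, ∫ e, F (obs Y (k + 1) ω, e) ∂(K (Y k ω)) ∂P := by
  have hm := measurable_obs hY.measurable (k + 1)
  have : IsProbabilityMeasure (P.map (obs Y (k + 1))) :=
    Measure.isProbabilityMeasure_map hm.aemeasurable
  rw [← integral_map (f := F) (φ := fun ω => (obs Y (k + 1) ω, Y (k + 1) ω))
    (hm.prodMk (hY.measurable _)).aemeasurable hF.aestronglyMeasurable, hY.map_eq,
    Measure.integral_compProd, integral_map hm.aemeasurable]
  · rfl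
  · exact (hF.stronglyMeasurable.integral_kernel_prod_right').aestronglyMeasurable
  · exact Integrable.of_bound hF.aestronglyMeasurable B (ae_of_all _ hB)

/-- A chain started in an invariant distribution is stationary. -/
theorem map_obs_shift (hY : IsMarkovChain P K Y) (hinv : K ∘ₘ (P.map (Y 0)) = P.map (Y 0))
    (N i : ℕ) : P.map (obs (fun j => Y (i + j)) N) = P.map (obs Y N) := by
  have hm : ∀ (n i : ℕ), Measurable (obs (fun j => Y (i + j)) n) := fun n i =>
    measurable_obs (fun j => hY.measurable _) n
  have hm0 : ∀ n, Measurable (obs Y n) := measurable_obs hY.measurable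
  have h1 : ∀ i, P.map (Y i) = P.map (Y 0) := by
    intro i
    induction i with
    | zero => rfl
    | succ i ih =>
      rw [← hinv, ← ih]
      ext A hA
      rw [Measure.bind_apply hA K.aemeasurable, lintegral_map (K.measurable_coe hA) (hY.measurable _),
        ← lintegral_indicator_one hA, lintegral_map (measurable_one.indicator hA) (hY.measurable _)]
      have := hY.lintegral_step i (F := fun p => A.indicator 1 p.2)
        ((measurable_one.indicator hA).comp measurable_snd)
      simp only at this
      rw [this]
      simp_rw [lintegral_indicator_one hA]
  induction N with
  | zero =>
    have : obs (fun j => Y (i + j)) 0 = obs Y 0 := by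
      funext ω; exact Subsingleton.elim _ _
    rw [this]
  | succ N ih =>
    cases N with
    | zero =>
      have e : ∀ i, obs (fun j => Y (i + j)) 1 = (fun e => fun _ : Fin 1 => e) ∘ Y i := by
        intro i; funext ω k; fin_cases k; simp [obs]
      have hc : Measurable (fun e : E => fun _ : Fin 1 => e) := measurable_pi_lambda _ fun _ => measurable_id
      have e0 : obs Y 1 = (fun e => fun _ : Fin 1 => e) ∘ Y 0 := by
        funext ω k; fin_cases k; simp [obs]
      rw [e, e0, ← Measure.map_map hc (hY.measurable _), ← Measure.map_map hc (hY.measurable _), h1]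
    | succ N =>
      -- All the shifted window laws obey the same recursion from length `N + 1` to length `N + 2`,
      -- so equality of the one-time marginals propagates to every length.
      have key : ∀ i, ∀ F : (Fin (N + 2) → E) → ℝ≥0∞, Measurable F →
          ∫⁻ v, F v ∂(P.map (obs (fun j => Y (i + j)) (N + 2))) =
          ∫⁻ v, ∫⁻ e, F (Fin.snoc (α := fun _ => E) v e) ∂(K (v (Fin.last N)))
            ∂(P.map (obs (fun j => Y (i + j)) (N + 1))) := by
        intro i F hF
        have hG : Measurable fun p : (Fin (N + 1) → E) × E => F (Fin.snoc (α := fun _ => E) p.1 p.2) :=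
          hF.comp (measurable_snoc _)
        rw [lintegral_map hF (hm _ _), lintegral_map _ (hm _ _)]
        · have := hY.lintegral_step (i + N)
            (F := fun p => F (Fin.snoc (α := fun _ => E) (fun l : Fin (N + 1) => p.1 ⟨i + l, by omega⟩) p.2))
            (hG.comp (f := fun p : (Fin (i + N + 1) → E) × E =>
              ((fun l : Fin (N + 1) => p.1 ⟨i + l, by omega⟩), p.2)) ((measurable_pi_lambda _ fun l =>
              (measurable_pi_apply _).comp measurable_fst).prodMk measurable_snd))
          simp_rw [obs_succ _ (N + 1)]
          exact this
        · exact hG.lintegral_kernel_prod_right' (κ := K.comap (fun v : Fin (N + 1) → E => v (Fin.last N))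
            (measurable_pi_apply _))
      refine Measure.ext_of_lintegral _ fun F hF => ?_
      have k0 := key 0 F hF
      simp only [zero_add] at k0
      rw [key i F hF, ih, k0]

/-- Induction on the window length. A function of a window minus its conditional mean given all but
the last state forms a bounded orthogonal sequence (`md`), and what remains is a function of a
shorter window. Windows of one state are handled by the Poisson equation. -/
theorem tendstoAverage_of_bounded (hY : IsMarkovChain P K Y) (hK : HasPoissonSolutions K) (N : ℕ)
    (h : (Fin (N + 1) → E) → ℝ) (hm : Measurable h) (B : ℝ) (hB : ∀ v, |h v| ≤ B) :
    ∃ c, TendstoAverage P (fun i ω => h (obs (fun j => Y (i + j)) (N + 1) ω)) c := by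
  have hobs : ∀ (n i : ℕ), Measurable (obs (fun j => Y (i + j)) n) := fun n i =>
    measurable_obs (fun j => hY.measurable _) n
  have hint : ∀ (N : ℕ) (h : (Fin N → E) → ℝ), Measurable h → ∀ B : ℝ, (∀ v, |h v| ≤ B) →
      ∀ i, Integrable (fun ω => h (obs (fun j => Y (i + j)) N ω)) P := fun N h hm B hB i =>
    Integrable.of_bound (hm.comp (hobs _ _)).aestronglyMeasurable B (ae_of_all _ fun ω => hB _)
  have kmeas : ∀ (N : ℕ) (h : (Fin (N + 2) → E) → ℝ), Measurable h →
      Measurable (fun v : Fin (N + 1) → E =>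
        ∫ e, h (Fin.snoc (α := fun _ => E) v e) ∂(K (v (Fin.last N)))) := by
    intro N h hm
    have := (hm.comp (measurable_snoc (N + 1))).stronglyMeasurable.integral_kernel_prod_right'
      (κ := K.comap (fun v : Fin (N + 1) → E => v (Fin.last N)) (measurable_pi_apply _))
    exact this.measurable
  have kbound : ∀ (N : ℕ) (h : (Fin (N + 2) → E) → ℝ) (B : ℝ), (∀ v, |h v| ≤ B) →
      ∀ v : Fin (N + 1) → E, |∫ e, h (Fin.snoc (α := fun _ => E) v e) ∂(K (v (Fin.last N)))| ≤ B := by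
    intro N h B hB v
    refine (norm_integral_le_of_norm_le_const (C := B) (μ := K (v (Fin.last N)))
      (f := fun e => h (Fin.snoc (α := fun _ => E) v e)) (ae_of_all _ fun e => ?_)).trans ?_
    · rw [Real.norm_eq_abs]
      exact hB _
    · simp
  have md : ∀ (N : ℕ) (h : (Fin (N + 2) → E) → ℝ), Measurable h → ∀ B : ℝ, (∀ v, |h v| ≤ B) →
      TendstoAverage P (fun i ω => h (obs (fun j => Y (i + j)) (N + 2) ω) -
        ∫ e, h (Fin.snoc (α := fun _ => E) (obs (fun j => Y (i + j)) (N + 1) ω) e)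
          ∂(K (Y (i + N) ω))) 0 := by
    intro N h hm B hB
    set D : (Fin (N + 2) → E) → ℝ := fun v => h v -
      ∫ e, h (Fin.snoc (α := fun _ => E) (fun l : Fin (N + 1) => v l.castSucc) e)
        ∂(K (v (Fin.last N).castSucc)) with hD
    have hDm : Measurable D := by
      refine hm.sub ?_
      exact (kmeas N h hm).comp (measurable_pi_lambda (fun (v : Fin (N + 2) → E) (l : Fin (N + 1)) =>
        v l.castSucc) fun l => measurable_pi_apply _)
    have hDB : ∀ v, |D v| ≤ B + B := fun v => (abs_sub _ _).trans
      (add_le_add (hB v) (kbound N h B hB fun l : Fin (N + 1) => v l.castSucc))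
    have e : (fun i ω => h (obs (fun j => Y (i + j)) (N + 2) ω) -
        ∫ e, h (Fin.snoc (α := fun _ => E) (obs (fun j => Y (i + j)) (N + 1) ω) e)
          ∂(K (Y (i + N) ω))) = fun i ω => D (obs (fun j => Y (i + j)) (N + 2) ω) := by
      funext i ω
      rfl
    rw [e]
    refine TendstoAverage.of_orthogonal (B := B + B) (fun i => hDm.comp (hobs _ _))
      (fun i ω => hDB _) fun i j hij => ?_
    have hBB : 0 ≤ B + B := (abs_nonneg _).trans (hDB fun _ => (Classical.choice
      (P.nonempty_of_neZero.map (Y 0))))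
    have hlm : Measurable fun p : (Fin (j + N + 1) → E) × E =>
        (fun l : Fin (N + 1) => p.1 ⟨j + l, by omega⟩) :=
      measurable_pi_lambda _ fun l => (measurable_pi_apply _).comp measurable_fst
    -- The window started at `i < j` ends no later than time `j + N`. Its factor is therefore
    -- already determined when the last state of the window started at `j` is drawn, and the
    -- conditional mean of the second factor is zero.
    have := hY.integral_step (j + N) (B := (B + B) * (B + B))
      (F := fun p => D (fun l : Fin (N + 2) => p.1 ⟨i + l, by omega⟩) *
        D (Fin.snoc (α := fun _ => E) (fun l : Fin (N + 1) => p.1 ⟨j + l, by omega⟩) p.2)) ?_ ?_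
    · have e2 : ∀ ω, D (obs (fun l => Y (j + l)) (N + 2) ω) = D (Fin.snoc (α := fun _ => E)
          (obs (fun l => Y (j + l)) (N + 1) ω) (Y (j + (N + 1)) ω)) := fun ω => by
        rw [obs_succ _ (N + 1)]
      simp_rw [e2]
      refine this.trans ?_
      rw [← integral_zero Ω ℝ (μ := P)]
      refine integral_congr_ae (ae_of_all _ fun ω => ?_)
      simp only
      rw [integral_const_mul, mul_eq_zero]
      right
      have e3 : ∀ x : E, D (Fin.snoc (α := fun _ => E)
          (fun l : Fin (N + 1) => obs Y (j + N + 1) ω ⟨j + l, by omega⟩) x) =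
          h (Fin.snoc (α := fun _ => E) (obs (fun l => Y (j + l)) (N + 1) ω) x) -
          ∫ e, h (Fin.snoc (α := fun _ => E) (obs (fun l => Y (j + l)) (N + 1) ω) e)
            ∂(K (Y (j + N) ω)) := by
        intro x
        simp only [hD, Fin.snoc_castSucc]
        rfl
      simp_rw [e3]
      rw [integral_sub _ (integrable_const _)]
      · simp
      · refine Integrable.of_bound (hm.comp ((measurable_snoc _).comp
          (f := fun x => (obs (fun l => Y (j + l)) (N + 1) ω, x))
          (measurable_const.prodMk measurable_id))).aestronglyMeasurable B (ae_of_all _ fun ω => hB _)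
    · refine (hDm.comp (measurable_pi_lambda _ fun l =>
        (measurable_pi_apply _).comp measurable_fst)).mul (hDm.comp ?_)
      exact (measurable_snoc (N + 1)).comp (hlm.prodMk measurable_snd)
    · intro x
      rw [abs_mul]
      exact mul_le_mul (hDB _) (hDB _) (abs_nonneg _) hBB
  induction N generalizing B with
  | zero =>
    obtain ⟨G, c, hG, ⟨C, hC⟩, hGc⟩ := hK (fun e => h fun _ => e)
      (hm.comp (measurable_pi_lambda _ fun _ => measurable_id)) ⟨B, fun e => hB _⟩
    have t1 := md 0 (fun v => G (v (Fin.last 1))) (hG.comp (measurable_pi_apply _)) C fun v => hC _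
    have t2 := TendstoAverage.of_telescope (P := P) (G := fun i ω => G (Y i ω)) (B := C)
      fun i ω => hC _
    have hGi : ∀ i, Integrable (fun ω => G (Y i ω)) P := fun i =>
      Integrable.of_bound (hG.comp (hY.measurable i)).aestronglyMeasurable C (ae_of_all _ fun ω => hC _)
    have hKGi : ∀ i, Integrable (fun ω => ∫ e, G e ∂(K (Y i ω))) P := fun i => by
      refine Integrable.of_bound (C := C) ?_ (ae_of_all _ fun ω => ?_)
      · have := (hG.comp measurable_snd).stronglyMeasurable.integral_kernel_prod_right' (κ := K)
        exact (this.measurable.comp (hY.measurable i)).aestronglyMeasurable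
      · exact (norm_integral_le_of_norm_le_const (ae_of_all _ fun e => hC _)).trans (by simp)
    have t3 : TendstoAverage P (fun i ω => G (Y (i + 1) ω) - ∫ e, G e ∂(K (Y i ω))) 0 := by
      refine t1.congr (fun i => ae_of_all _ fun ω => ?_) rfl
      simp only [Fin.snoc_last]
      rfl
    -- By the Poisson equation `h(Y_i)` is the sum of the martingale difference `G(Y_{i+1}) -
    -- KG(Y_i)`, the telescoping term `G(Y_i) - G(Y_{i+1})` and the constant `c`.
    have t4 := (t3.add (fun i => (hGi _).sub (hKGi i)) (fun i => (hGi _).sub (hGi _)) t2).add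
      (fun i => ((hGi _).sub (hKGi i)).add ((hGi _).sub (hGi _))) (fun i => integrable_const c)
      (TendstoAverage.of_const c)
    refine ⟨0 + 0 + c, t4.congr (fun i => ae_of_all _ fun ω => ?_) rfl⟩
    have e0 : obs (fun j => Y (i + j)) (0 + 1) ω = fun _ => Y i ω := by
      funext k; fin_cases k; simp [obs]
    simp only [e0, Pi.add_apply, Pi.sub_apply]
    linarith [hGc (Y i ω)]
  | succ N ih =>
    obtain ⟨c, hc⟩ := ih _ (kmeas N h hm) B (kbound N h B hB)
    refine ⟨0 + c, ((md N h hm B hB).add (fun i => ?_) (fun i => hint _ _ (kmeas N h hm) B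
      (kbound N h B hB) i) hc).congr (fun i => ae_of_all _ fun ω => ?_) rfl⟩
    · exact (hint _ h hm B hB i).sub (hint _ _ (kmeas N h hm) B (kbound N h B hB) i)
    · exact sub_add_cancel _ _

/-- The law of large numbers for functions of consecutive states of a stationary chain. -/
theorem tendstoAverage (hY : IsMarkovChain P K Y) (hK : HasPoissonSolutions K)
    (hinv : K ∘ₘ (P.map (Y 0)) = P.map (Y 0)) (N : ℕ) (h : (Fin (N + 1) → E) → ℝ)
    (hm : Measurable h) (hi : Integrable (fun ω => h (obs Y (N + 1) ω)) P) :
    TendstoAverage P (fun i ω => h (obs (fun j => Y (i + j)) (N + 1) ω))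
      (∫ ω, h (obs Y (N + 1) ω) ∂P) := by
  have hobs : ∀ (n i : ℕ), Measurable (obs (fun j => Y (i + j)) n) := fun n i =>
    measurable_obs (fun j => hY.measurable _) n
  have hobs0 := measurable_obs hY.measurable (N + 1)
  have hid : ∀ i, IdentDistrib (obs (fun j => Y (i + j)) (N + 1)) (obs Y (N + 1)) P P := fun i =>
    ⟨(hobs _ _).aemeasurable, hobs0.aemeasurable, hY.map_obs_shift hinv _ _⟩
  have hint : ∀ i, Integrable (fun ω => h (obs (fun j => Y (i + j)) (N + 1) ω)) P := fun i =>
    ((hid i).comp hm).integrable_iff.2 hi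
  refine TendstoAverage.of_approx hint fun ε hε => ?_
  -- Truncation of `h` at level `M`. By stationarity its `L¹` distance to `h` is the same for all
  -- windows, so a single `M` serves them all.
  set g : ℕ → (Fin (N + 1) → E) → ℝ := fun M v => max (-(M : ℝ)) (min (M : ℝ) (h v)) with hg
  have gm : ∀ M, Measurable (g M) := fun M => measurable_const.max (measurable_const.min hm)
  have gB : ∀ M v, |g M v| ≤ M := fun M v => by
    have : (0 : ℝ) ≤ M := Nat.cast_nonneg M
    rw [abs_le]
    exact ⟨le_max_left _ _, max_le (by linarith) (min_le_left _ _)⟩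
  have gle : ∀ M v, |h v - g M v| ≤ |h v| := fun M v => by
    have : (0 : ℝ) ≤ M := Nat.cast_nonneg M
    simp only [hg]
    rcases le_total (M : ℝ) (h v) with h1 | h1
    · rw [min_eq_left h1, max_eq_right (by linarith), abs_of_nonneg (by linarith),
        abs_of_nonneg (by linarith)]
      linarith
    · rw [min_eq_right h1]
      rcases le_total (-(M : ℝ)) (h v) with h2 | h2
      · rw [max_eq_right h2]; simp
      · rw [max_eq_left h2, abs_of_nonpos (by linarith), abs_of_nonpos (by linarith)]
        linarith
  have glim : Tendsto (fun M : ℕ => ∫ ω, |h (obs Y (N + 1) ω) - g M (obs Y (N + 1) ω)| ∂P) atTop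
      (𝓝 (∫ _, 0 ∂P)) := by
    refine tendsto_integral_of_dominated_convergence (fun ω => |h (obs Y (N + 1) ω)|)
      (fun M => ((hm.sub (gm M)).comp hobs0).abs.aestronglyMeasurable) hi.abs
      (fun M => ae_of_all _ fun ω => by simpa using gle M _) (ae_of_all _ fun ω => ?_)
    obtain ⟨M, hM⟩ := exists_nat_ge |h (obs Y (N + 1) ω)|
    refine tendsto_const_nhds.congr' ((eventually_ge_atTop M).mono fun n hn => ?_)
    have hn' : |h (obs Y (N + 1) ω)| ≤ n := hM.trans (Nat.cast_le.2 hn)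
    rw [abs_le] at hn'
    simp only [hg]
    rw [min_eq_right hn'.2, max_eq_right hn'.1]; simp
  rw [integral_zero] at glim
  obtain ⟨M, hM⟩ := (glim.eventually_le_const hε).exists
  obtain ⟨d, hd⟩ := hY.tendstoAverage_of_bounded hK N (g M) (gm M) M (gB M)
  have gi : ∀ i, Integrable (fun ω => g M (obs (fun j => Y (i + j)) (N + 1) ω)) P := fun i =>
    Integrable.of_bound ((gm M).comp (hobs _ _)).aestronglyMeasurable M (ae_of_all _ fun ω => gB M _)
  have gi0 : Integrable (fun ω => g M (obs Y (N + 1) ω)) P :=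
    Integrable.of_bound ((gm M).comp hobs0).aestronglyMeasurable M (ae_of_all _ fun ω => gB M _)
  have hd' := hd.eq_mean gi (fun i => ((hid i).comp (gm M)).integral_eq)
  refine ⟨_, d, gi, hd, ?_, fun i => ?_⟩
  · rw [hd', abs_sub_comm]
    simp only [Function.comp_apply]
    rw [← integral_sub hi gi0]
    exact (abs_integral_le_integral_abs).trans hM
  · refine le_of_eq_of_le ?_ hM
    exact ((hid i).comp (hm.sub (gm M)).abs).integral_eq

end IsMarkovChain

/-! ### The Poisson equation on a finite state space -/

section FiniteChain

variable {S : Type*} [Fintype S]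

/-- The maximum principle: a function which is harmonic for an irreducible stochastic matrix is
constant. -/
theorem eq_of_harmonic {A : S → S → ℝ} (hA : ∀ x y, 0 ≤ A x y) (hA1 : ∀ x, ∑ y, A x y = 1)
    (hirr : ∀ x y, Relation.ReflTransGen (fun x y => 0 < A x y) x y) {u : S → ℝ}
    (hu : ∀ x, ∑ y, A x y * u y = u x) (x y : S) : u x = u y := by
  obtain ⟨x₀, -, hx₀⟩ := Finset.exists_max_image Finset.univ u ⟨x, Finset.mem_univ x⟩
  have key : ∀ y, u y = u x₀ := by
    intro y
    induction hirr x₀ y with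
    | refl => rfl
    | @tail b c _ hbc ih =>
      -- At a maximizer `b` the nonnegative terms sum to zero, so every state that `b` reaches with
      -- positive probability is a maximizer too.
      have h0 : ∑ y, A b y * (u x₀ - u y) = 0 := by
        simp_rw [mul_sub]
        rw [Finset.sum_sub_distrib, hu b, ← Finset.sum_mul, hA1, ih]; ring
      have h1 := (Finset.sum_eq_zero_iff_of_nonneg fun y _ =>
        mul_nonneg (hA b y) (sub_nonneg.2 (hx₀ y (Finset.mem_univ _)))).1 h0 c (Finset.mem_univ _)
      rcases mul_eq_zero.1 h1 with h | h
      · exact absurd h hbc.ne'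
      · linarith
  rw [key x, key y]

/-- The Poisson equation of an irreducible stochastic matrix is solvable. -/
theorem exists_poisson_solution [Nonempty S] {A : S → S → ℝ} (hA : ∀ x y, 0 ≤ A x y)
    (hA1 : ∀ x, ∑ y, A x y = 1)
    (hirr : ∀ x y, Relation.ReflTransGen (fun x y => 0 < A x y) x y) {p : S → ℝ}
    (hp1 : ∑ x, p x = 1) (hpA : ∀ y, ∑ x, p x * A x y = p y) (φ : S → ℝ) :
    ∃ u : S → ℝ, ∀ x, u x - ∑ y, A x y * u y = φ x - ∑ y, p y * φ y := by
  classical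
  let T : (S → ℝ) →ₗ[ℝ] (S → ℝ) := LinearMap.id - Matrix.toLin' (Matrix.of A)
  have hT : ∀ u x, T u x = u x - ∑ y, A x y * u y := fun u x => by
    simp [T, Matrix.mulVec, dotProduct]
  let ℓ : (S → ℝ) →ₗ[ℝ] ℝ := ∑ x, p x • LinearMap.proj x
  have hℓ : ∀ u, ℓ u = ∑ y, p y * u y := fun u => by simp [ℓ, LinearMap.sum_apply]
  have hle : LinearMap.range T ≤ LinearMap.ker ℓ := by
    rintro _ ⟨u, rfl⟩
    rw [LinearMap.mem_ker, hℓ]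
    simp_rw [hT, mul_sub, Finset.sum_sub_distrib, Finset.mul_sum]
    rw [Finset.sum_comm, sub_eq_zero]
    refine Finset.sum_congr rfl fun y _ => ?_
    simp_rw [← mul_assoc]
    rw [← Finset.sum_mul, hpA]
  have hker : Module.finrank ℝ (LinearMap.ker T) ≤ 1 := by
    refine finrank_le_one (⟨fun _ => 1, ?_⟩ : LinearMap.ker T) fun w => ?_
    · rw [LinearMap.mem_ker]
      funext x
      rw [hT]; simp [hA1]
    · obtain ⟨x₀⟩ := ‹Nonempty S›
      refine ⟨(w : S → ℝ) x₀, ?_⟩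
      ext x
      have hw : ∀ x, ∑ y, A x y * (w : S → ℝ) y = (w : S → ℝ) x := fun x => by
        have := congrFun (LinearMap.mem_ker.1 w.2) x
        rw [hT] at this
        simp only [Pi.zero_apply] at this
        linarith
      simpa using eq_of_harmonic hA hA1 hirr hw x₀ x
  have hsurj : LinearMap.range ℓ = ⊤ := by
    rw [LinearMap.range_eq_top]
    intro c
    exact ⟨fun _ => c, by rw [hℓ, ← Finset.sum_mul, hp1, one_mul]⟩
  have h1 := LinearMap.finrank_range_add_finrank_ker T
  have h2 := LinearMap.finrank_range_add_finrank_ker ℓ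
  rw [hsurj, finrank_top, Module.finrank_self] at h2
  -- The kernel of `T = 1 - A` is at most one-dimensional, so its range has codimension at most one.
  -- It lies in the hyperplane of the functions with `p`-mean zero and hence fills it.
  have heq : LinearMap.range T = LinearMap.ker ℓ :=
    Submodule.eq_of_le_of_finrank_le hle (by omega)
  have hmem : (fun x => φ x - ∑ y, p y * φ y) ∈ LinearMap.ker ℓ := by
    rw [LinearMap.mem_ker, hℓ]
    simp_rw [mul_sub, Finset.sum_sub_distrib, ← Finset.sum_mul, hp1, one_mul, sub_self]
  rw [← heq] at hmem
  obtain ⟨u, hu⟩ := hmem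
  exact ⟨u, fun x => by rw [← hT, hu]⟩

theorem sum_fin_succ_eq_sum_snoc {M : Type*} [AddCommMonoid M] (n : ℕ) (G : (Fin (n + 1) → S) → M) :
    ∑ x, G x = ∑ x : Fin n → S, ∑ y, G (Fin.snoc (α := fun _ => S) x y) := by
  rw [← (Fin.snocEquiv fun _ : Fin (n + 1) => S).sum_comp, Fintype.sum_prod_type_right]
  rfl

end FiniteChain

/-! ### The hidden Markov model as a Markov chain of pairs -/

theorem lintegral_pi_succ {𝒵 : Type*} [MeasurableSpace 𝒵] (ν : Measure 𝒵) [SigmaFinite ν] (n : ℕ)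
    {G : (Fin (n + 1) → 𝒵) → ℝ≥0∞} (hG : Measurable G) :
    ∫⁻ z, G z ∂(Measure.pi fun _ => ν) =
      ∫⁻ z, ∫⁻ z', G (Fin.snoc (α := fun _ => 𝒵) z z') ∂ν ∂(Measure.pi fun _ : Fin n => ν) := by
  have h := (measurePreserving_piFinSuccAbove (fun _ : Fin (n + 1) => ν) (Fin.last n)).symm
  rw [← h.lintegral_comp hG, lintegral_prod_symm]
  · simp [MeasurableEquiv.piFinSuccAbove, Fin.insertNthEquiv, Fin.insertNth_last']
  · exact (hG.comp (MeasurableEquiv.measurable _)).aemeasurable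

namespace HMMModel

variable {S 𝒵 Ω : Type*} [Fintype S] [MeasurableSpace 𝒵] [MeasurableSpace Ω] {ν : Measure 𝒵}
  (m : HMMModel S 𝒵 ν)

theorem pathProb_snoc (k : ℕ) (x : Fin (k + 1) → S) (y : S) :
    m.pathProb (k + 2) (Fin.snoc (α := fun _ => S) x y) =
      m.pathProb (k + 1) x * m.trans (x (Fin.last k)) y := by
  simp only [pathProb]
  rw [Fin.prod_univ_castSucc, ← mul_assoc]
  have h0 : Fin.snoc (α := fun _ => S) x y 0 = x 0 := Fin.snoc_castSucc (α := fun _ => S) y x 0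
  simp only [h0, Fin.snoc_castSucc, ← Fin.castSucc_succ, Fin.succ_last, Fin.snoc_last]

theorem condDensity_snoc (k : ℕ) (x : Fin k → S) (y : S) (z : Fin k → 𝒵) (z' : 𝒵) :
    m.condDensity (Fin.snoc (α := fun _ => S) x y) (Fin.snoc (α := fun _ => 𝒵) z z') =
      m.condDensity x z * m.f y z' := by
  simp [condDensity, Fin.prod_univ_castSucc]

theorem measurable_condDensity {k : ℕ} (x : Fin k → S) :
    Measurable fun z : Fin k → 𝒵 => m.condDensity x z := by
  unfold condDensity
  exact Finset.measurable_prod _ fun i _ => (m.measurable_f (x i)).comp (measurable_pi_apply i)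

theorem sum_pmf (q : PMF S) : ∑ x, q x = 1 := by
  rw [← tsum_fintype (L := .unconditional S), q.tsum_coe]

/-- The joint law of a state with law `q` and of an observation given this state. -/
noncomputable def stateObsLaw [MeasurableSpace S] (q : PMF S) : Measure (S × 𝒵) :=
  ∑ y, q y • (ν.withDensity (m.f y)).map (Prod.mk y)

section Law

variable [MeasurableSpace S]

theorem lintegral_stateObsLaw (q : PMF S) {F : S × 𝒵 → ℝ≥0∞} (hF : Measurable F) :
    ∫⁻ e, F e ∂(m.stateObsLaw q) = ∑ y, q y * ∫⁻ z, m.f y z * F (y, z) ∂ν := by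
  unfold stateObsLaw
  rw [lintegral_finsetSum_measure]
  refine Finset.sum_congr rfl fun y _ => ?_
  have hFy : Measurable fun z => F (y, z) := hF.comp measurable_prodMk_left
  rw [lintegral_smul_measure, lintegral_map hF measurable_prodMk_left,
    lintegral_withDensity_eq_lintegral_mul _ (m.measurable_f y) hFy]
  rfl

instance (y : S) : IsProbabilityMeasure (ν.withDensity (m.f y)) :=
  ⟨by rw [withDensity_apply _ MeasurableSet.univ, Measure.restrict_univ, m.lintegral_f]⟩

instance : IsProbabilityMeasure (ν.withDensity m.f₀) :=
  ⟨by rw [withDensity_apply _ MeasurableSet.univ, Measure.restrict_univ, m.lintegral_f₀]⟩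

instance (q : PMF S) : IsProbabilityMeasure (m.stateObsLaw q) :=
  ⟨by rw [← lintegral_one, m.lintegral_stateObsLaw q measurable_const]; simp [m.lintegral_f, sum_pmf]⟩

theorem integral_stateObsLaw (q : PMF S) {F : S × 𝒵 → ℝ} (hF : Measurable F) {B : ℝ}
    (hB : ∀ e, |F e| ≤ B) :
    ∫ e, F e ∂(m.stateObsLaw q) = ∑ y, (q y).toReal * ∫ z, F (y, z) ∂(ν.withDensity (m.f y)) := by
  have hi : ∀ y, Integrable F ((ν.withDensity (m.f y)).map (Prod.mk y)) := fun y => by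
    have : IsProbabilityMeasure ((ν.withDensity (m.f y)).map (Prod.mk y)) :=
      Measure.isProbabilityMeasure_map measurable_prodMk_left.aemeasurable
    exact Integrable.of_bound hF.aestronglyMeasurable B (ae_of_all _ hB)
  unfold stateObsLaw
  rw [integral_finsetSum_measure fun y _ => (hi y).smul_measure (q.apply_ne_top y)]
  refine Finset.sum_congr rfl fun y _ => ?_
  rw [integral_smul_measure, integral_map measurable_prodMk_left.aemeasurable
    hF.aestronglyMeasurable, smul_eq_mul]

variable [DiscreteMeasurableSpace S]

/-- The transition kernel of the pair consisting of the state and of the observation. -/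
noncomputable def pairKernel : Kernel (S × 𝒵) (S × 𝒵) :=
  (⟨fun x => m.stateObsLaw (m.trans x), Measurable.of_discrete⟩ : Kernel S (S × 𝒵)).comap Prod.fst
    measurable_fst

theorem pairKernel_apply (e : S × 𝒵) : m.pairKernel e = m.stateObsLaw (m.trans e.1) := rfl

instance : IsMarkovKernel m.pairKernel := ⟨fun e => by rw [pairKernel_apply]; infer_instance⟩

variable [SigmaFinite ν] {P : Measure Ω} {X : ℕ → Ω → S} {Z : ℕ → Ω → 𝒵}

variable {m}

/-- Splitting `Ω` by the trajectory of the states turns the set identity that defines the model into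
an integral identity. -/
theorem IsSignal.lintegral_obs (h : m.IsSignal P X Z) (k : ℕ)
    {F : (Fin k → S) → (Fin k → 𝒵) → ℝ≥0∞} (hF : ∀ x, Measurable (F x)) :
    ∫⁻ ω, F (obs X k ω) (obs Z k ω) ∂P = ∑ x : Fin k → S, m.pathProb k x *
      ∫⁻ z, m.condDensity x z * F x z ∂(Measure.pi fun _ : Fin k => ν) := by
  classical
  obtain ⟨hX, hZ, hP⟩ := h
  have hXm := measurable_obs hX k
  have hZm := measurable_obs hZ k
  have e : ∀ ω, F (obs X k ω) (obs Z k ω) =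
      ∑ x : Fin k → S, (obs X k ⁻¹' {x}).indicator (fun ω => F x (obs Z k ω)) ω := by
    intro ω
    rw [Finset.sum_eq_single_of_mem (obs X k ω) (Finset.mem_univ _)]
    · rw [indicator_of_mem (by simp)]
    · intro x _ hx
      rw [indicator_of_notMem]
      simpa using fun h => hx h.symm
  simp_rw [e]
  have hs : ∀ x, MeasurableSet (obs X k ⁻¹' {x}) := fun x => hXm (measurableSet_singleton x)
  have hFZ : ∀ x, Measurable fun ω => F x (obs Z k ω) := fun x => (hF x).comp hZm
  rw [lintegral_finsetSum _ fun x _ => (hFZ x).indicator (hs x)]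
  refine Finset.sum_congr rfl fun x _ => ?_
  rw [lintegral_indicator (hs x), ← lintegral_map (hF x) hZm]
  have : (P.restrict (obs X k ⁻¹' {x})).map (obs Z k) =
      m.pathProb k x • (Measure.pi fun _ : Fin k => ν).withDensity (m.condDensity x) := by
    ext A hA
    rw [Measure.map_apply hZm hA, Measure.restrict_apply (hZm hA), Measure.smul_apply,
      withDensity_apply _ hA, smul_eq_mul, ← hP k x A hA]
    congr 1
    ext ω
    simp [and_comm]
  rw [this, lintegral_smul_measure, lintegral_withDensity_eq_lintegral_mul _
    (m.measurable_condDensity x) (hF x)]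
  rfl

/-- One more step multiplies the joint density by `a(x, y) f(z | y)`. Integrating the last
coordinate separately exhibits this factor as the transition kernel. -/
theorem IsSignal.isMarkovChain [IsProbabilityMeasure P] (h : m.IsSignal P X Z) :
    IsMarkovChain P m.pairKernel (fun i ω => (X i ω, Z i ω)) := by
  have hY : ∀ i, Measurable fun ω => (X i ω, Z i ω) := fun i => (h.1 i).prodMk (h.2.1 i)
  refine ⟨hY, fun k => Measure.ext_of_lintegral _ fun F hF => ?_⟩
  have hm := measurable_obs hY (k + 1)
  have : IsProbabilityMeasure (P.map (obs (fun i ω => (X i ω, Z i ω)) (k + 1))) :=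
    Measure.isProbabilityMeasure_map hm.aemeasurable
  rw [lintegral_map hF (hm.prodMk (hY _)), Measure.lintegral_compProd hF, lintegral_map _ hm]
  swap
  · exact hF.lintegral_kernel_prod_right'
  have hzip : ∀ n (x : Fin n → S), Measurable fun z : Fin n → 𝒵 => fun l => (x l, z l) := fun n x =>
    measurable_pi_lambda _ fun l => measurable_const.prodMk (measurable_pi_apply l)
  have hF1 : ∀ x : Fin (k + 2) → S, Measurable fun z : Fin (k + 2) → 𝒵 =>
      F (fun l : Fin (k + 1) => (x l.castSucc, z l.castSucc),
        (x (Fin.last (k + 1)), z (Fin.last (k + 1)))) := fun x =>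
    hF.comp ((measurable_pi_lambda _ fun l => measurable_const.prodMk (measurable_pi_apply _)).prodMk
      (measurable_const.prodMk (measurable_pi_apply _)))
  have hF2 : ∀ (x : Fin (k + 1) → S) (y : S), Measurable fun p : (Fin (k + 1) → 𝒵) × 𝒵 =>
      m.f y p.2 * F (fun l => (x l, p.1 l), (y, p.2)) := fun x y =>
    ((m.measurable_f y).comp measurable_snd).mul
      (hF.comp (((hzip _ x).comp measurable_fst).prodMk (measurable_const.prodMk measurable_snd)))
  have lhs := h.lintegral_obs (k + 2) hF1
  have hF3 : ∀ x : Fin (k + 1) → S, Measurable fun z : Fin (k + 1) → 𝒵 =>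
      ∑ y, m.trans (x (Fin.last k)) y * ∫⁻ z', m.f y z' * F (fun l => (x l, z l), (y, z')) ∂ν :=
    fun x => Finset.measurable_sum _ fun y _ => ((hF2 x y).lintegral_prod_right').const_mul _
  have rhs := h.lintegral_obs (k + 1) hF3
  refine lhs.trans (Eq.trans ?_ (rhs.symm.trans ?_))
  · rw [sum_fin_succ_eq_sum_snoc]
    refine Finset.sum_congr rfl fun x _ => ?_
    simp_rw [pathProb_snoc, mul_assoc]
    rw [← Finset.mul_sum]
    congr 1
    simp_rw [Finset.mul_sum]
    rw [lintegral_finsetSum]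
    · refine Finset.sum_congr rfl fun y _ => ?_
      have hm1 := (hF2 x y).lintegral_prod_right' (ν := ν)
      have e1 : ∀ z : Fin (k + 1) → 𝒵, m.condDensity x z * (m.trans (x (Fin.last k)) y *
          ∫⁻ z', m.f y z' * F (fun l => (x l, z l), (y, z')) ∂ν) = m.trans (x (Fin.last k)) y *
          (m.condDensity x z * ∫⁻ z', m.f y z' * F (fun l => (x l, z l), (y, z')) ∂ν) := fun z => by
        ring
      simp_rw [e1]
      have hm2 : Measurable fun z => m.condDensity x z *
          ∫⁻ z', m.f y z' * F (fun l => (x l, z l), (y, z')) ∂ν := (m.measurable_condDensity x).mul hm1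
      have hm3 : Measurable fun z : Fin (k + 2) → 𝒵 =>
          m.condDensity (Fin.snoc (α := fun _ => S) x y) z *
            F (fun l => (Fin.snoc (α := fun _ => S) x y l.castSucc, z l.castSucc),
              (Fin.snoc (α := fun _ => S) x y (Fin.last (k + 1)), z (Fin.last (k + 1)))) :=
        (m.measurable_condDensity _).mul (hF1 _)
      rw [lintegral_const_mul _ hm2, lintegral_pi_succ _ _ hm3]
      congr 1
      refine lintegral_congr fun z => ?_
      simp_rw [condDensity_snoc, Fin.snoc_castSucc, Fin.snoc_last, mul_assoc]
      rw [lintegral_const_mul]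
      exact (hF2 x y).comp measurable_prodMk_left
    · exact fun y _ => (m.measurable_condDensity x).mul
        (((hF2 x y).lintegral_prod_right').const_mul _)
  · refine lintegral_congr fun ω => ?_
    rw [Kernel.comap_apply, pairKernel_apply, m.lintegral_stateObsLaw]
    · rfl
    · exact hF.comp measurable_prodMk_left

theorem IsSignal.map_zero (h : m.IsSignal P X Z) :
    P.map (fun ω => (X 0 ω, Z 0 ω)) = m.stateObsLaw m.init := by
  refine Measure.ext_of_lintegral _ fun F hF => ?_
  have hF1 : ∀ x : Fin 1 → S, Measurable fun z : Fin 1 → 𝒵 => F (x 0, z 0) := fun x =>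
    hF.comp (measurable_const.prodMk (measurable_pi_apply _))
  rw [lintegral_map hF ((h.1 0).prodMk (h.2.1 0)), m.lintegral_stateObsLaw _ hF]
  refine (h.lintegral_obs 1 hF1).trans ?_
  rw [sum_fin_succ_eq_sum_snoc, Fintype.sum_unique]
  refine Finset.sum_congr rfl fun y _ => ?_
  have e0 : Fin.snoc (α := fun _ => S) (default : Fin 0 → S) y 0 = y := by
    exact Fin.snoc_last (α := fun _ => S) (n := 0) y default
  have e1 : ∀ (z : Fin 0 → 𝒵) (z' : 𝒵), Fin.snoc (α := fun _ => 𝒵) z z' 0 = z' := fun z z' =>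
    Fin.snoc_last (α := fun _ => 𝒵) (n := 0) z' z
  have hm : Measurable fun z : Fin 1 → 𝒵 => m.condDensity (Fin.snoc (α := fun _ => S)
      (default : Fin 0 → S) y) z * F (Fin.snoc (α := fun _ => S) (default : Fin 0 → S) y 0, z 0) :=
    (m.measurable_condDensity _).mul (hF1 _)
  rw [lintegral_pi_succ _ _ hm]
  simp only [pathProb, condDensity_snoc, e0, e1]
  simp [condDensity]

theorem IsSignal.comp_map_zero (h : m.IsSignal P X Z) (hC : m.StationaryErgodicChain) :
    m.pairKernel ∘ₘ (P.map (fun ω => (X 0 ω, Z 0 ω))) = P.map (fun ω => (X 0 ω, Z 0 ω)) := by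
  rw [h.map_zero]
  refine Measure.ext_of_lintegral _ fun F hF => ?_
  rw [Measure.lintegral_bind m.pairKernel.aemeasurable hF.aemeasurable]
  simp_rw [pairKernel_apply, m.lintegral_stateObsLaw _ hF]
  have hm : Measurable fun x : S => ∑ y, m.trans x y * ∫⁻ z, m.f y z * F (y, z) ∂ν :=
    Measurable.of_discrete
  have hm' : Measurable fun e : S × 𝒵 => ∑ y, m.trans e.1 y * ∫⁻ z, m.f y z * F (y, z) ∂ν :=
    hm.comp measurable_fst
  rw [m.lintegral_stateObsLaw _ hm']
  have e : ∀ y, ∫⁻ z, m.f y z * ∑ y', m.trans y y' * ∫⁻ z, m.f y' z * F (y', z) ∂ν ∂ν =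
      ∑ y', m.trans y y' * ∫⁻ z, m.f y' z * F (y', z) ∂ν := fun y => by
    rw [lintegral_mul_const _ (m.measurable_f y), m.lintegral_f, one_mul]
  simp_rw [e, Finset.mul_sum]
  rw [Finset.sum_comm]
  refine Finset.sum_congr rfl fun y _ => ?_
  simp_rw [← mul_assoc]
  rw [← Finset.sum_mul, hC.1]

end Law

/-- A positive entry of a matrix power contains a positive product of entries, that is, a path of
possible transitions. In this form irreducibility supports inductions along paths. -/
theorem StationaryErgodicChain.reflTransGen {m : HMMModel S 𝒵 ν} (hC : m.StationaryErgodicChain)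
    (x y : S) : Relation.ReflTransGen (fun x y => 0 < m.trans x y) x y := by
  classical
  obtain ⟨n, hn⟩ := hC.2.1 x y
  unfold nStep at hn
  induction n generalizing y with
  | zero =>
    by_cases hxy : x = y
    · subst hxy; exact Relation.ReflTransGen.refl
    · simp [hxy] at hn
  | succ n ih =>
    rw [pow_succ, Matrix.mul_apply] at hn
    obtain ⟨w, -, hw⟩ := Finset.exists_ne_zero_of_sum_ne_zero hn.ne'
    have h1 := left_ne_zero_of_mul hw
    have h2 := right_ne_zero_of_mul hw
    exact (ih w (pos_iff_ne_zero.2 h1)).tail (pos_iff_ne_zero.2 h2)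

/-- Stationarity carries positive mass from a state to each of its successors, and irreducibility
makes every state reachable from the support. -/
theorem StationaryErgodicChain.init_pos {m : HMMModel S 𝒵 ν} (hC : m.StationaryErgodicChain)
    (y : S) : 0 < m.init y := by
  obtain ⟨x, hx⟩ := m.init.support_nonempty
  induction hC.reflTransGen x y with
  | refl => exact pos_iff_ne_zero.2 ((PMF.mem_support_iff _ _).1 hx)
  | @tail b c _ hbc ih =>
    rw [← hC.1 c]
    refine lt_of_lt_of_le (ENNReal.mul_pos ih.ne' hbc.ne') ?_
    exact Finset.single_le_sum (f := fun x => m.init x * m.trans x c) (fun _ _ => zero_le)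
      (Finset.mem_univ b)

/-- The kernel forgets the observation, so the one-step mean `φ` of `h` depends on the state alone.
If `u` solves the finite Poisson equation for `φ`, then `G = h + u` works: applying the kernel to
`G` gives `φ + Au`, and `u - Au` cancels `φ` up to its mean. -/
theorem StationaryErgodicChain.hasPoissonSolutions [MeasurableSpace S] [DiscreteMeasurableSpace S]
    {m : HMMModel S 𝒵 ν} (hC : m.StationaryErgodicChain) : HasPoissonSolutions m.pairKernel := by
  intro h hh ⟨B, hB⟩
  have : Nonempty S := ⟨m.init.support_nonempty.some⟩
  have hreal : ∀ q : PMF S, ∑ x, (q x).toReal = 1 := fun q => by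
    rw [← ENNReal.toReal_sum fun x _ => q.apply_ne_top x, sum_pmf]; rfl
  set φ : S → ℝ := fun x => ∑ y, (m.trans x y).toReal * ∫ z, h (y, z) ∂(ν.withDensity (m.f y))
    with hφ
  obtain ⟨u, hu⟩ := exists_poisson_solution (A := fun x y => (m.trans x y).toReal)
    (p := fun x => (m.init x).toReal) (fun _ _ => ENNReal.toReal_nonneg) (fun x => hreal _)
    (fun x y => Relation.ReflTransGen.mono (r := fun x y => 0 < m.trans x y) (fun a b hab =>
      ENNReal.toReal_pos (ne_of_gt hab) ((m.trans a).apply_ne_top b)) x y (hC.reflTransGen x y))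
    (hreal _) (fun y => by
      rw [← hC.1 y, ENNReal.toReal_sum fun x _ =>
        ENNReal.mul_ne_top (m.init.apply_ne_top x) ((m.trans x).apply_ne_top y)]
      simp [ENNReal.toReal_mul])
    φ
  obtain ⟨C, hCu⟩ : ∃ C, ∀ x, |u x| ≤ C := by
    obtain ⟨C, hC⟩ := (Set.finite_range fun x => |u x|).bddAbove
    exact ⟨C, fun x => hC ⟨x, rfl⟩⟩
  have hum : Measurable fun e : S × 𝒵 => u e.1 := (Measurable.of_discrete (f := u)).comp measurable_fst
  refine ⟨fun e => h e + u e.1, ∑ x, (m.init x).toReal * φ x, hh.add hum, ⟨B + C, fun e => (abs_add_le _ _).trans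
    (add_le_add (hB e) (hCu e.1))⟩, fun e => ?_⟩
  · have hi : Integrable h (m.pairKernel e) :=
      Integrable.of_bound hh.aestronglyMeasurable B (ae_of_all _ hB)
    have hui : Integrable (fun e : S × 𝒵 => u e.1) (m.pairKernel e) :=
      Integrable.of_bound hum.aestronglyMeasurable C (ae_of_all _ fun e => hCu e.1)
    rw [integral_add hi hui, pairKernel_apply, m.integral_stateObsLaw _ hh hB,
      m.integral_stateObsLaw _ hum fun e => hCu e.1]
    have := hu e.1
    simp only [integral_const, probReal_univ, one_smul]
    linarith

/-- The law of large numbers for functions of consecutive observations. -/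
theorem IsSignal.tendstoAverage [MeasurableSpace S] [DiscreteMeasurableSpace S] [SigmaFinite ν]
    {m : HMMModel S 𝒵 ν} {P : Measure Ω} [IsProbabilityMeasure P] {X : ℕ → Ω → S} {Z : ℕ → Ω → 𝒵}
    (h : m.IsSignal P X Z) (hC : m.StationaryErgodicChain) (N : ℕ) {g : (Fin (N + 1) → 𝒵) → ℝ}
    (hg : Measurable g) (hi : Integrable (fun ω => g (obs Z (N + 1) ω)) P) :
    TendstoAverage P (fun i ω => g (obs (fun j => Z (i + j)) (N + 1) ω))
      (∫ ω, g (obs Z (N + 1) ω) ∂P) :=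
  h.isMarkovChain.tendstoAverage hC.hasPoissonSolutions (h.comp_map_zero hC) N
    (fun v => g fun l => (v l).2)
    (hg.comp (measurable_pi_lambda _ fun l => measurable_snd.comp (measurable_pi_apply l))) hi

theorem IsSignal.map_obs_shift [MeasurableSpace S] [DiscreteMeasurableSpace S] [SigmaFinite ν]
    {m : HMMModel S 𝒵 ν} {P : Measure Ω} [IsProbabilityMeasure P] {X : ℕ → Ω → S} {Z : ℕ → Ω → 𝒵}
    (h : m.IsSignal P X Z) (hC : m.StationaryErgodicChain) (N i : ℕ) :
    P.map (obs (fun j => Z (i + j)) N) = P.map (obs Z N) := by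
  have hp : Measurable fun v : Fin N → S × 𝒵 => fun l => (v l).2 :=
    measurable_pi_lambda _ fun l => measurable_snd.comp (measurable_pi_apply l)
  have h1 := congrArg (Measure.map fun v : Fin N → S × 𝒵 => fun l => (v l).2)
    (h.isMarkovChain.map_obs_shift (h.comp_map_zero hC) N i)
  rw [Measure.map_map hp (measurable_obs (fun j => h.isMarkovChain.measurable _) _),
    Measure.map_map hp (measurable_obs h.isMarkovChain.measurable _)] at h1
  exact h1

end HMMModel

/-! ### Ergodic observation sequences under both hypotheses -/

/-- A stationary sequence that satisfies the law of large numbers for the functions of finitely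
many consecutive terms. -/
structure IsErgodicSequence {Ω 𝒵 : Type*} [MeasurableSpace Ω] [MeasurableSpace 𝒵] (P : Measure Ω)
    (Z : ℕ → Ω → 𝒵) : Prop where
  measurable : ∀ i, Measurable (Z i)
  map_shift : ∀ N i, P.map (obs (fun j => Z (i + j)) N) = P.map (obs Z N)
  average : ∀ (N : ℕ) (g : (Fin (N + 1) → 𝒵) → ℝ), Measurable g →
    Integrable (fun ω => g (obs Z (N + 1) ω)) P →
    TendstoAverage P (fun i ω => g (obs (fun j => Z (i + j)) (N + 1) ω))
      (∫ ω, g (obs Z (N + 1) ω) ∂P)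

theorem lintegral_pi_withDensity {𝒵 : Type*} [MeasurableSpace 𝒵] (ν : Measure 𝒵) [SigmaFinite ν]
    {g : 𝒵 → ℝ≥0∞} (hg : Measurable g) [SigmaFinite (ν.withDensity g)] (k : ℕ)
    {F : (Fin k → 𝒵) → ℝ≥0∞} (hF : Measurable F) :
    ∫⁻ z, F z ∂(Measure.pi fun _ : Fin k => ν.withDensity g) =
      ∫⁻ z, (∏ i, g (z i)) * F z ∂(Measure.pi fun _ : Fin k => ν) := by
  induction k with
  | zero =>
    rw [Measure.pi_of_empty _ (default : Fin 0 → 𝒵), Measure.pi_of_empty _ (default : Fin 0 → 𝒵)]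
    simp
  | succ k ih =>
    have hp : ∀ k, Measurable fun z : Fin k → 𝒵 => ∏ i, g (z i) := fun k =>
      Finset.measurable_prod _ fun i _ => hg.comp (measurable_pi_apply i)
    have h2 : Measurable fun p : (Fin k → 𝒵) × 𝒵 => F (Fin.snoc (α := fun _ => 𝒵) p.1 p.2) :=
      hF.comp (measurable_snoc k)
    have h1 : Measurable fun p : (Fin k → 𝒵) × 𝒵 =>
        g p.2 * F (Fin.snoc (α := fun _ => 𝒵) p.1 p.2) := (hg.comp measurable_snd).mul h2
    have h3 : ∀ z : Fin k → 𝒵, Measurable fun z' => F (Fin.snoc (α := fun _ => 𝒵) z z') := fun z =>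
      h2.comp measurable_prodMk_left
    have h4 : ∀ z : Fin k → 𝒵, Measurable fun z' => g z' * F (Fin.snoc (α := fun _ => 𝒵) z z') :=
      fun z => hg.mul (h3 z)
    have h5 : Measurable fun z : Fin (k + 1) → 𝒵 => (∏ i, g (z i)) * F z := (hp _).mul hF
    rw [lintegral_pi_succ _ _ hF, lintegral_pi_succ _ _ h5]
    have e : ∀ z : Fin k → 𝒵, ∫⁻ z', F (Fin.snoc (α := fun _ => 𝒵) z z') ∂(ν.withDensity g) =
        ∫⁻ z', g z' * F (Fin.snoc (α := fun _ => 𝒵) z z') ∂ν := fun z => by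
      rw [lintegral_withDensity_eq_lintegral_mul _ hg (h3 z)]; rfl
    simp_rw [e]
    rw [ih h1.lintegral_prod_right']
    refine lintegral_congr fun z => ?_
    simp_rw [Fin.prod_univ_castSucc, Fin.snoc_castSucc, Fin.snoc_last, mul_assoc]
    rw [lintegral_const_mul _ (h4 z)]

namespace HMMModel

variable {S 𝒵 Ω : Type*} [Fintype S] [MeasurableSpace 𝒵] [MeasurableSpace Ω] {ν : Measure 𝒵}

theorem IsSignal.isErgodicSequence [MeasurableSpace S] [DiscreteMeasurableSpace S] [SigmaFinite ν]
    {m : HMMModel S 𝒵 ν} {P : Measure Ω} [IsProbabilityMeasure P] {X : ℕ → Ω → S} {Z : ℕ → Ω → 𝒵}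
    (h : m.IsSignal P X Z) (hC : m.StationaryErgodicChain) : IsErgodicSequence P Z :=
  ⟨h.2.1, h.map_obs_shift hC, fun N _ hg hi => h.tendstoAverage hC N hg hi⟩

theorem IsNoise.map_obs {m : HMMModel S 𝒵 ν} {P : Measure Ω} [IsProbabilityMeasure P]
    {Z : ℕ → Ω → 𝒵} (h : m.IsNoise P Z) (k : ℕ) :
    P.map (obs Z k) = Measure.pi fun _ : Fin k => ν.withDensity m.f₀ := by
  have hi : iIndepFun (fun i : Fin k => Z i) P := h.2.1.precomp Fin.val_injective
  have := iIndepFun.map_fun_eq_pi_map (fun i : Fin k => (h.1 i).aemeasurable) hi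
  simp only [h.2.2] at this
  exact this

theorem IsNoise.lintegral_obs [SigmaFinite ν] {m : HMMModel S 𝒵 ν} {P : Measure Ω}
    [IsProbabilityMeasure P] {Z : ℕ → Ω → 𝒵} (h : m.IsNoise P Z) (k : ℕ)
    {F : (Fin k → 𝒵) → ℝ≥0∞} (hF : Measurable F) :
    ∫⁻ ω, F (obs Z k ω) ∂P =
      ∫⁻ z, m.noiseDensity z * F z ∂(Measure.pi fun _ : Fin k => ν) := by
  rw [← lintegral_map hF (measurable_obs h.1 k), h.map_obs,
    lintegral_pi_withDensity ν m.measurable_f₀ k hF]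
  rfl

/-- Independent and identically distributed observations as a hidden Markov model with one state. -/
noncomputable def noiseModel (m : HMMModel S 𝒵 ν) : HMMModel Unit 𝒵 ν where
  init := PMF.pure ()
  trans _ := PMF.pure ()
  f _ := m.f₀
  f₀ := m.f₀
  measurable_f _ := m.measurable_f₀
  measurable_f₀ := m.measurable_f₀
  lintegral_f _ := m.lintegral_f₀
  lintegral_f₀ := m.lintegral_f₀

theorem nStep_zero_self (m : HMMModel S 𝒵 ν) (x : S) : m.nStep 0 x x = 1 := by
  classical
  unfold nStep
  rw [pow_zero, Matrix.one_apply_eq]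

theorem nStep_one (m : HMMModel S 𝒵 ν) (x y : S) : m.nStep 1 x y = m.trans x y := by
  classical
  unfold nStep
  rw [pow_one, Matrix.of_apply]

theorem stationaryErgodicChain_noiseModel (m : HMMModel S 𝒵 ν) :
    m.noiseModel.StationaryErgodicChain := by
  refine ⟨fun y => ?_, fun x y => ⟨0, ?_⟩, fun x d hd => ?_⟩
  · simp [noiseModel]
  · obtain rfl : x = y := rfl
    rw [nStep_zero_self]
    exact one_pos
  -- The only state has a loop of probability one, so the period divides `1`.
  · have := hd 1 le_rfl (by rw [nStep_one]; simp [noiseModel])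
    exact Nat.dvd_one.1 this

theorem IsNoise.isSignal_noiseModel [SigmaFinite ν] {m : HMMModel S 𝒵 ν} {P : Measure Ω}
    [IsProbabilityMeasure P] {Z : ℕ → Ω → 𝒵} (h : m.IsNoise P Z) :
    m.noiseModel.IsSignal P (fun _ _ => ()) Z := by
  refine ⟨fun _ => measurable_const, h.1, fun k x A hA => ?_⟩
  have e1 : {ω | obs (fun _ _ => ()) k ω = x ∧ obs Z k ω ∈ A} = obs Z k ⁻¹' A := by
    ext ω
    have : obs (fun _ _ => ()) k ω = x := Subsingleton.elim _ _
    simp [this]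
  have e2 : m.noiseModel.pathProb k x = 1 := by
    cases k <;> simp [pathProb, noiseModel]
  rw [e1, e2, one_mul, ← lintegral_indicator_one (measurable_obs h.1 k hA),
    ← lintegral_indicator hA]
  refine (h.lintegral_obs k (measurable_one.indicator hA)).trans (lintegral_congr fun z => ?_)
  by_cases hz : z ∈ A
  · simp [hz, noiseDensity, condDensity, noiseModel]
  · simp [hz]

theorem IsNoise.isErgodicSequence [SigmaFinite ν] {m : HMMModel S 𝒵 ν} {P : Measure Ω}
    [IsProbabilityMeasure P] {Z : ℕ → Ω → 𝒵} (h : m.IsNoise P Z) : IsErgodicSequence P Z :=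
  h.isSignal_noiseModel.isErgodicSequence m.stationaryErgodicChain_noiseModel

/-! ### Forward recursion and subadditivity of the log-likelihood ratio -/

/-- The weights of the states at time `k` in the recursive computation of the sum, over the
trajectories, of products of weights `w`. -/
noncomputable def forwardWeight (m : HMMModel S 𝒵 ν) (w : ℕ → S → ℝ≥0∞) : ℕ → S → ℝ≥0∞
  | 0, y => m.init y
  | k + 1, y => ∑ x, m.forwardWeight w k x * w k x * m.trans x y

variable (m : HMMModel S 𝒵 ν)

theorem sum_forwardWeight_succ (w : ℕ → S → ℝ≥0∞) (k : ℕ) :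
    ∑ y, m.forwardWeight w (k + 1) y = ∑ x, m.forwardWeight w k x * w k x := by
  simp only [forwardWeight]
  rw [Finset.sum_comm]
  simp_rw [← Finset.mul_sum, sum_pmf, mul_one]

/-- The arbitrary function `φ` of the last state is what makes the induction close: removing a step
replaces `φ` by `w k` times the transition mean of `φ`. -/
theorem sum_pathProb_mul (w : ℕ → S → ℝ≥0∞) (k : ℕ) (φ : S → ℝ≥0∞) :
    ∑ x : Fin (k + 1) → S, m.pathProb (k + 1) x * (∏ i : Fin k, w i (x i.castSucc)) *
      φ (x (Fin.last k)) = ∑ y, m.forwardWeight w k y * φ y := by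
  induction k generalizing φ with
  | zero =>
    rw [sum_fin_succ_eq_sum_snoc, Fintype.sum_unique]
    refine Finset.sum_congr rfl fun y _ => ?_
    have e0 : Fin.snoc (α := fun _ => S) (default : Fin 0 → S) y 0 = y :=
      Fin.snoc_last (α := fun _ => S) (n := 0) y default
    simp [pathProb, forwardWeight, e0]
  | succ k ih =>
    rw [sum_fin_succ_eq_sum_snoc]
    have := ih (fun x => w k x * ∑ y, m.trans x y * φ y)
    refine Eq.trans ?_ (this.trans ?_)
    · refine Finset.sum_congr rfl fun x _ => ?_
      simp_rw [Finset.mul_sum]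
      refine Finset.sum_congr rfl fun y _ => ?_
      rw [pathProb_snoc, Fin.prod_univ_castSucc]
      simp only [Fin.snoc_castSucc, Fin.snoc_last, Fin.val_castSucc, Fin.val_last]
      ring
    · simp only [forwardWeight]
      simp_rw [Finset.sum_mul, Finset.mul_sum]
      rw [Finset.sum_comm]
      refine Finset.sum_congr rfl fun x _ => Finset.sum_congr rfl fun y _ => ?_
      ring

theorem sum_pathProb_mul_prod (w : ℕ → S → ℝ≥0∞) (k : ℕ) :
    ∑ x : Fin k → S, m.pathProb k x * ∏ i : Fin k, w i (x i) = ∑ y, m.forwardWeight w k y := by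
  cases k with
  | zero => simp [pathProb, forwardWeight, sum_pmf]
  | succ k =>
    rw [sum_forwardWeight_succ, ← sum_pathProb_mul]
    refine Finset.sum_congr rfl fun x _ => ?_
    rw [Fin.prod_univ_castSucc]
    simp only [Fin.val_castSucc, Fin.val_last]
    ring

theorem forwardWeight_congr {w w' : ℕ → S → ℝ≥0∞} (k : ℕ) (h : ∀ i < k, w i = w' i) (y : S) :
    m.forwardWeight w k y = m.forwardWeight w' k y := by
  induction k generalizing y with
  | zero => rfl
  | succ k ih =>
    simp only [forwardWeight]
    simp_rw [h k (Nat.lt_succ_self k), ih fun i hi => h i (hi.trans (Nat.lt_succ_self k))]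

/-- The weight of a state at time `n` is at most the total weight, hence at most `C` times the total
times its initial probability. The recursion is linear with nonnegative coefficients, so this
comparison with a chain restarted from `init` survives all later steps. -/
theorem forwardWeight_add_le {C : ℝ≥0∞} (hC : ∀ y, 1 ≤ C * m.init y) (w : ℕ → S → ℝ≥0∞) (n k : ℕ)
    (y : S) : m.forwardWeight w (n + k) y ≤
      C * (∑ x, m.forwardWeight w n x) * m.forwardWeight (fun i => w (n + i)) k y := by
  induction k generalizing y with
  | zero =>
    calc m.forwardWeight w n y ≤ ∑ x, m.forwardWeight w n x :=
          Finset.single_le_sum (f := m.forwardWeight w n) (fun _ _ => zero_le) (Finset.mem_univ y)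
      _ = 1 * ∑ x, m.forwardWeight w n x := (one_mul _).symm
      _ ≤ (C * m.init y) * ∑ x, m.forwardWeight w n x := by gcongr; exact hC y
      _ = _ := by simp only [forwardWeight]; ring
  | succ k ih =>
    rw [← add_assoc]
    simp only [forwardWeight]
    rw [Finset.mul_sum]
    refine Finset.sum_le_sum fun x _ => ?_
    calc _ ≤ (C * (∑ x, m.forwardWeight w n x) * m.forwardWeight (fun i => w (n + i)) k x) *
          w (n + k) x * m.trans x y := by gcongr; exact ih x
      _ = _ := by ring

/-- The likelihood ratio of one observation given the state. -/
noncomputable def stateRatio (x : S) (z : 𝒵) : ℝ≥0∞ := m.f x z / m.f₀ z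

theorem measurable_stateRatio (x : S) : Measurable (m.stateRatio x) :=
  (m.measurable_f x).div m.measurable_f₀

/-- The observations all of whose likelihood ratios are positive and finite. -/
def regularObs : Set 𝒵 := {z | ∀ x, m.stateRatio x z ≠ 0 ∧ m.stateRatio x z ≠ ∞}

theorem noise_ne_zero_of_mem_regularObs {z : 𝒵} (hz : z ∈ m.regularObs) : m.f₀ z ≠ 0 := by
  obtain ⟨x, -⟩ := m.init.support_nonempty
  intro h0
  have := hz x
  unfold stateRatio at this
  rw [h0] at this
  by_cases hf : m.f x z = 0
  · simp [hf] at this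
  · exact this.2 (ENNReal.div_zero hf)

theorem noise_ne_top_of_mem_regularObs {z : 𝒵} (hz : z ∈ m.regularObs) : m.f₀ z ≠ ∞ := by
  obtain ⟨x, -⟩ := m.init.support_nonempty
  intro h0
  have := hz x
  unfold stateRatio at this
  rw [h0, ENNReal.div_top] at this
  exact this.1 rfl

section Pointwise

variable {z : ℕ → 𝒵}

/-- Regularity makes the noise densities finite, which allows the quotient of products to be written
as a product of quotients in `ℝ≥0∞`. -/
theorem likelihoodRatio_eq_sum (hz : ∀ i, z i ∈ m.regularObs) (k : ℕ) :
    m.likelihoodRatio (fun i : Fin k => z i) =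
      ∑ y, m.forwardWeight (fun i x => m.stateRatio x (z i)) k y := by
  rw [← sum_pathProb_mul_prod]
  unfold likelihoodRatio condDensity noiseDensity stateRatio
  refine Finset.sum_congr rfl fun x _ => ?_
  rw [ENNReal.prod_div_distrib_of_ne_top (f := fun i : Fin k => m.f (x i) (z i))
    (g := fun i : Fin k => m.f₀ (z i)) fun i _ => m.noise_ne_top_of_mem_regularObs (hz i)]

theorem likelihoodRatio_succ_eq_sum (hz : ∀ i, z i ∈ m.regularObs) (k : ℕ) :
    m.likelihoodRatio (fun i : Fin (k + 1) => z i) =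
      ∑ y, m.forwardWeight (fun i x => m.stateRatio x (z i)) k y * m.stateRatio y (z k) := by
  rw [m.likelihoodRatio_eq_sum hz, sum_forwardWeight_succ]

theorem likelihoodRatio_zero (z : Fin 0 → 𝒵) : m.likelihoodRatio z = 1 := by
  simp [likelihoodRatio, pathProb, condDensity, noiseDensity]

/-- A bound of the logarithms of the likelihood ratios of one observation. -/
noncomputable def logBound (z : 𝒵) : ℝ := ∑ x, |Real.log (m.stateRatio x z).toReal|

theorem logBound_nonneg (z : 𝒵) : 0 ≤ m.logBound z := Finset.sum_nonneg fun _ _ => abs_nonneg _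

theorem measurable_logBound : Measurable m.logBound :=
  Finset.measurable_sum _ fun x _ =>
    (Real.measurable_log.comp (m.measurable_stateRatio x).ennreal_toReal).abs

theorem stateRatio_bounds {z : 𝒵} (hz : z ∈ m.regularObs) (x : S) :
    ENNReal.ofReal (Real.exp (-m.logBound z)) ≤ m.stateRatio x z ∧
      m.stateRatio x z ≤ ENNReal.ofReal (Real.exp (m.logBound z)) := by
  have hpos := ENNReal.toReal_pos (hz x).1 (hz x).2
  have h1 : |Real.log (m.stateRatio x z).toReal| ≤ m.logBound z :=
    Finset.single_le_sum (f := fun x => |Real.log (m.stateRatio x z).toReal|)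
      (fun _ _ => abs_nonneg _) (Finset.mem_univ x)
  rw [abs_le] at h1
  rw [← ENNReal.ofReal_toReal (hz x).2]
  constructor
  · exact ENNReal.ofReal_le_ofReal ((Real.le_log_iff_exp_le hpos).1 h1.1)
  · exact ENNReal.ofReal_le_ofReal ((Real.log_le_iff_le_exp hpos).1 h1.2)

/-- A new observation multiplies each forward weight by a ratio between `exp (-logBound)` and `exp
logBound`, so the total changes by at most these factors. -/
theorem likelihoodRatio_succ_bounds (hz : ∀ i, z i ∈ m.regularObs) (k : ℕ) :
    m.likelihoodRatio (fun i : Fin k => z i) * ENNReal.ofReal (Real.exp (-m.logBound (z k))) ≤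
        m.likelihoodRatio (fun i : Fin (k + 1) => z i) ∧
      m.likelihoodRatio (fun i : Fin (k + 1) => z i) ≤
        m.likelihoodRatio (fun i : Fin k => z i) * ENNReal.ofReal (Real.exp (m.logBound (z k))) := by
  rw [m.likelihoodRatio_eq_sum hz k, m.likelihoodRatio_succ_eq_sum hz k, Finset.sum_mul,
    Finset.sum_mul]
  constructor
  · gcongr with x
    exact (m.stateRatio_bounds (hz k) x).1
  · gcongr with x
    exact (m.stateRatio_bounds (hz k) x).2

theorem likelihoodRatio_ne (hz : ∀ i, z i ∈ m.regularObs) (k : ℕ) :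
    m.likelihoodRatio (fun i : Fin k => z i) ≠ 0 ∧ m.likelihoodRatio (fun i : Fin k => z i) ≠ ∞ := by
  induction k with
  | zero => rw [likelihoodRatio_zero]; simp
  | succ k ih =>
    obtain ⟨h1, h2⟩ := m.likelihoodRatio_succ_bounds hz k
    constructor
    · refine (lt_of_lt_of_le (ENNReal.mul_pos ih.1 ?_) h1).ne'
      simpa using Real.exp_pos _
    · exact (h2.trans_lt (ENNReal.mul_lt_top ih.2.lt_top ENNReal.ofReal_lt_top)).ne

/-- The logarithm of the likelihood ratio of `k` observations. -/
noncomputable def logLR {k : ℕ} (z : Fin k → 𝒵) : ℝ := Real.log (m.likelihoodRatio z).toReal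

theorem measurable_logLR (k : ℕ) : Measurable fun z : Fin k → 𝒵 => m.logLR z :=
  Real.measurable_log.comp (m.measurable_likelihoodRatio k).ennreal_toReal

theorem likelihoodRatio_eq_exp (hz : ∀ i, z i ∈ m.regularObs) (k : ℕ) :
    m.likelihoodRatio (fun i : Fin k => z i) =
      ENNReal.ofReal (Real.exp (m.logLR fun i : Fin k => z i)) := by
  obtain ⟨h1, h2⟩ := m.likelihoodRatio_ne hz k
  rw [logLR, Real.exp_log (ENNReal.toReal_pos h1 h2), ENNReal.ofReal_toReal h2]

theorem logLR_succ_bounds (hz : ∀ i, z i ∈ m.regularObs) (k : ℕ) :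
    m.logLR (fun i : Fin k => z i) ≤ m.logLR (fun i : Fin (k + 1) => z i) + m.logBound (z k) ∧
      m.logLR (fun i : Fin (k + 1) => z i) ≤ m.logLR (fun i : Fin k => z i) + m.logBound (z k) := by
  obtain ⟨h1, h2⟩ := m.likelihoodRatio_succ_bounds hz k
  rw [m.likelihoodRatio_eq_exp hz k, m.likelihoodRatio_eq_exp hz (k + 1),
    ← ENNReal.ofReal_mul (Real.exp_pos _).le, ← Real.exp_add,
    ENNReal.ofReal_le_ofReal_iff (Real.exp_pos _).le, Real.exp_le_exp] at h1 h2
  constructor <;> linarith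

theorem abs_logLR_le (hz : ∀ i, z i ∈ m.regularObs) (k : ℕ) :
    |m.logLR (fun i : Fin k => z i)| ≤ ∑ i ∈ Finset.range k, m.logBound (z i) := by
  induction k with
  | zero => simp [logLR, likelihoodRatio_zero]
  | succ k ih =>
    obtain ⟨h1, h2⟩ := m.logLR_succ_bounds hz k
    rw [Finset.sum_range_succ]
    rw [abs_le] at ih ⊢
    constructor <;> linarith [ih.1, ih.2]

theorem logLR_add_le {C : ℝ} (hC0 : 0 < C) (hC : ∀ y, 1 ≤ ENNReal.ofReal C * m.init y)
    (hz : ∀ i, z i ∈ m.regularObs) (n k : ℕ) :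
    m.logLR (fun i : Fin (n + k) => z i) ≤ m.logLR (fun i : Fin n => z i) +
      m.logLR (fun i : Fin k => z (n + i)) + Real.log C := by
  have h : m.likelihoodRatio (fun i : Fin (n + k) => z i) ≤ ENNReal.ofReal C *
      m.likelihoodRatio (fun i : Fin n => z i) * m.likelihoodRatio (fun i : Fin k => z (n + i)) := by
    rw [m.likelihoodRatio_eq_sum hz, m.likelihoodRatio_eq_sum hz,
      m.likelihoodRatio_eq_sum (z := fun i => z (n + i)) (fun i => hz _), Finset.mul_sum]
    exact Finset.sum_le_sum fun y _ => m.forwardWeight_add_le hC _ n k y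
  rw [m.likelihoodRatio_eq_exp hz, m.likelihoodRatio_eq_exp hz,
    m.likelihoodRatio_eq_exp (z := fun i => z (n + i)) (fun i => hz _), ← Real.exp_log hC0,
    ← ENNReal.ofReal_mul (Real.exp_pos _).le, ← ENNReal.ofReal_mul (by positivity), ← Real.exp_add,
    ← Real.exp_add, ENNReal.ofReal_le_ofReal_iff (Real.exp_pos _).le, Real.exp_le_exp] at h
  linarith

end Pointwise

theorem StationaryErgodicChain.exists_const {m : HMMModel S 𝒵 ν} (hC : m.StationaryErgodicChain) :
    ∃ C : ℝ, 0 < C ∧ ∀ y, 1 ≤ ENNReal.ofReal C * m.init y := by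
  have hne : ∀ y, (m.init y)⁻¹ ≠ ∞ := fun y => ENNReal.inv_ne_top.2 (hC.init_pos y).ne'
  -- The sum dominates each inverse initial probability; the summand `1` only secures positivity.
  refine ⟨(∑ y, (m.init y)⁻¹).toReal + 1, by positivity, fun y => ?_⟩
  have h1 : (m.init y)⁻¹ ≤ ENNReal.ofReal ((∑ y, (m.init y)⁻¹).toReal + 1) := by
    calc (m.init y)⁻¹ ≤ ∑ y, (m.init y)⁻¹ :=
          Finset.single_le_sum (f := fun y => (m.init y)⁻¹) (fun _ _ => zero_le) (Finset.mem_univ y)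
      _ = ENNReal.ofReal (∑ y, (m.init y)⁻¹).toReal :=
          (ENNReal.ofReal_toReal (ENNReal.sum_ne_top.2 fun y _ => hne y)).symm
      _ ≤ _ := ENNReal.ofReal_le_ofReal (by linarith)
  calc 1 = (m.init y)⁻¹ * m.init y :=
        (ENNReal.inv_mul_cancel (hC.init_pos y).ne' (m.init.apply_ne_top y)).symm
    _ ≤ _ := by gcongr

/-- Off the regular observations some logarithm has absolute value `∞`, and a finite integral allows
that only on a null set. -/
theorem FiniteLogMoment.ae_mem {m : HMMModel S 𝒵 ν} {P : Measure Ω} {Z : ℕ → Ω → 𝒵}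
    (hZ : Measurable (Z 0)) (h : m.FiniteLogMoment P Z) : ∀ᵐ ω ∂P, Z 0 ω ∈ m.regularObs := by
  have : ∀ x, ∀ᵐ ω ∂P, m.stateRatio x (Z 0 ω) ≠ 0 ∧ m.stateRatio x (Z 0 ω) ≠ ∞ := by
    intro x
    set A : Set Ω := {ω | m.stateRatio x (Z 0 ω) = 0 ∨ m.stateRatio x (Z 0 ω) = ∞} with hA
    have hr : Measurable fun ω => m.stateRatio x (Z 0 ω) := (m.measurable_stateRatio x).comp hZ
    have hAm : MeasurableSet A :=
      (hr (measurableSet_singleton 0)).union (hr (measurableSet_singleton ∞))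
    have hle : ∞ * P A < ∞ := by
      rw [← lintegral_indicator_const hAm]
      refine lt_of_le_of_lt (lintegral_mono fun ω => ?_) (h x)
      refine indicator_le (s := A) (f := fun _ => ∞)
        (g := fun ω => (ENNReal.log (m.f x (Z 0 ω) / m.f₀ (Z 0 ω))).abs) (fun ω hω => ?_) ω
      unfold stateRatio at hA
      rcases hω with h0 | h0
      · unfold stateRatio at h0
        rw [h0]; simp
      · unfold stateRatio at h0
        rw [h0]; simp
    have hA0 : P A = 0 := by
      by_contra hne
      rw [ENNReal.top_mul hne] at hle
      exact hle.ne rfl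
    filter_upwards [measure_eq_zero_iff_ae_notMem.1 hA0] with ω hω
    simpa [hA] using hω
  filter_upwards [ae_all_iff.2 this] with ω hω using hω

theorem FiniteLogMoment.integrable_logBound {m : HMMModel S 𝒵 ν} {P : Measure Ω} {Z : ℕ → Ω → 𝒵}
    (hZ : Measurable (Z 0)) (h : m.FiniteLogMoment P Z) :
    Integrable (fun ω => m.logBound (Z 0 ω)) P := by
  refine integrable_finsetSum _ fun x _ => ?_
  refine ⟨((Real.measurable_log.comp (m.measurable_stateRatio x).ennreal_toReal).comp
    hZ).abs.aestronglyMeasurable, ?_⟩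
  refine lt_of_le_of_lt (lintegral_mono_ae ?_) (h x)
  filter_upwards [h.ae_mem hZ] with ω hω
  have := ENNReal.log_pos_real (hω x).1 (hω x).2
  unfold stateRatio at this
  rw [this, EReal.abs_def]
  rw [Real.enorm_eq_ofReal_abs, abs_abs]
  rfl

end HMMModel

/-! ### A subadditive ergodic theorem in `L¹` -/

section Subadditive

variable {Ω : Type*} [MeasurableSpace Ω] {P : Measure Ω} [IsProbabilityMeasure P]

/-- The means converge by Fekete's lemma. The positive part of the deviation tends to zero in mean
because subadditivity over windows of length `N + 1` bounds `L 0 n` by `(N + 1)⁻¹` times a sum over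
all window positions, up to boundary terms of bounded mean. Since the deviation itself has mean
tending to zero, its negative part vanishes as well. -/
theorem exists_tendsto_of_subadditive {L : ℕ → ℕ → Ω → ℝ} {W : ℕ → Ω → ℝ} {w c : ℝ}
    (hL : ∀ i n, Integrable (L i n) P) (hW : ∀ i, Integrable (W i) P) (hW0 : ∀ i ω, 0 ≤ W i ω)
    (hWw : ∀ i, ∫ ω, W i ω ∂P ≤ w)
    (hsub : ∀ᵐ ω ∂P, ∀ n k, L 0 (n + k) ω ≤ L 0 n ω + L n k ω)
    (hmono : ∀ᵐ ω ∂P, ∀ n, L 0 n ω ≤ L 0 (n + 1) ω + W n ω)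
    (habs : ∀ n : ℕ, -(n * w + c) ≤ ∫ ω, L 0 n ω ∂P)
    (hmean : ∀ i n, ∫ ω, L i n ω ∂P = ∫ ω, L 0 n ω ∂P)
    (havg : ∀ N, TendstoAverage P (fun i ω => L i (N + 1) ω) (∫ ω, L 0 (N + 1) ω ∂P)) :
    ∃ l : ℝ, Tendsto (fun n : ℕ => (∫ ω, L 0 n ω ∂P) / (n : ℝ)) atTop (𝓝 l) ∧
      Tendsto (fun n : ℕ => ∫ ω, |L 0 n ω / (n : ℝ) - l| ∂P) atTop (𝓝 0) := by
  set u : ℕ → ℝ := fun n => ∫ ω, L 0 n ω ∂P with hu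
  have husub : Subadditive u := fun n k => by
    calc u (n + k) ≤ ∫ ω, (L 0 n ω + L n k ω) ∂P :=
          integral_mono_ae (hL _ _) ((hL _ _).add (hL _ _)) (hsub.mono fun ω h => h n k)
      _ = u n + u k := by rw [integral_add (hL _ _) (hL _ _), hmean n k]
  have hw : 0 ≤ w := (integral_nonneg (hW0 0)).trans (hWw 0)
  have hbdd : BddBelow (range fun n => u n / n) := by
    refine ⟨-(w + |c|), ?_⟩
    rintro _ ⟨n, rfl⟩
    -- Division by zero gives the value `0` at `n = 0`, which must respect the lower bound too.
    rcases Nat.eq_zero_or_pos n with rfl | hn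
    · simp only [Nat.cast_zero, div_zero]
      linarith [abs_nonneg c]
    · have hn1 : (1 : ℝ) ≤ n := Nat.one_le_cast.2 hn
      simp only
      rw [le_div_iff₀ (by linarith)]
      have := habs n
      have h1 : |c| ≤ |c| * n := le_mul_of_one_le_right (abs_nonneg _) hn1
      nlinarith [le_abs_self c]
  have hlim := husub.tendsto_lim hbdd
  set l := husub.lim
  refine ⟨l, hlim, ?_⟩
  set a : ℕ → Ω → ℝ := fun n ω => L 0 n ω / (n : ℝ) - l with ha
  have hai : ∀ n, Integrable (a n) P := fun n => ((hL 0 n).div_const _).sub (integrable_const _)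
  have hap : ∀ n, Integrable (fun ω => max (a n ω) 0) P := fun n => (hai n).pos_part
  have hpos : Tendsto (fun n : ℕ => ∫ ω, max (a n ω) 0 ∂P) atTop (𝓝 0) := by
    rw [Metric.tendsto_atTop]
    intro ε hε
    obtain ⟨N, hN0, hN⟩ : ∃ N : ℕ, 1 ≤ N ∧ u N / N ≤ l + ε / 4 :=
      ((eventually_ge_atTop 1).and (hlim.eventually_le_const (by linarith))).exists
    obtain ⟨N, rfl⟩ : ∃ N', N = N' + 1 := ⟨N - 1, by omega⟩
    have hNpos : (0 : ℝ) < ((N + 1 : ℕ) : ℝ) := by positivity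
    have hN1 : (1 : ℝ) ≤ ((N + 1 : ℕ) : ℝ) := Nat.one_le_cast.2 hN0
    -- Boundary terms: the initial segments, and the increments paid for extending `L 0 n` to `L 0
    -- (n + k)`. Their mean is bounded independently of `n`, so they disappear after division by
    -- `n`.
    set R : ℕ → Ω → ℝ := fun n ω => ∑ i ∈ Finset.range (N + 1), |L 0 i ω| +
      ∑ i ∈ Finset.range (N + 1), ∑ j ∈ Finset.range i, W (n + j) ω with hR
    have hRi : ∀ n, Integrable (R n) P := fun n =>
      (integrable_finsetSum _ fun i _ => (hL 0 i).abs).add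
        (integrable_finsetSum _ fun i _ => integrable_finsetSum _ fun j _ => hW _)
    set K : ℝ := ∑ i ∈ Finset.range (N + 1), ∫ ω, |L 0 i ω| ∂P +
      ∑ i ∈ Finset.range (N + 1), ∑ j ∈ Finset.range i, w with hK
    have hRK : ∀ n, ∫ ω, R n ω ∂P ≤ K := by
      intro n
      simp only [hR]
      rw [integral_add (integrable_finsetSum _ fun i _ => (hL 0 i).abs)
        (integrable_finsetSum _ fun i _ => integrable_finsetSum _ fun j _ => hW _),
        integral_finsetSum _ fun i _ => (hL 0 i).abs,
        integral_finsetSum _ fun i _ => integrable_finsetSum _ fun j _ => hW _]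
      refine add_le_add le_rfl (Finset.sum_le_sum fun i _ => ?_)
      rw [integral_finsetSum _ fun j _ => hW _]
      exact Finset.sum_le_sum fun j _ => hWw _
    have key : ∀ᵐ ω ∂P, ∀ n : ℕ, 0 < n → max (a n ω) 0 ≤
        |(∑ i ∈ Finset.range n, L i (N + 1) ω) / (n : ℝ) - u (N + 1)| + ε / 4 + R n ω / n := by
      filter_upwards [hsub, hmono] with ω h1 h2 n hn
      have hn' : (0 : ℝ) < n := Nat.cast_pos.2 hn
      have hR0 : 0 ≤ R n ω := add_nonneg (Finset.sum_nonneg fun i _ => abs_nonneg _)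
        (Finset.sum_nonneg fun i _ => Finset.sum_nonneg fun j _ => hW0 _ _)
      refine max_le ?_ (by positivity)
      have s1 : ∀ k, L 0 n ω ≤ L 0 (n + k) ω + ∑ j ∈ Finset.range k, W (n + j) ω := by
        intro k
        induction k with
        | zero => simp
        | succ k ih =>
          rw [Finset.sum_range_succ]
          have := h2 (n + k)
          rw [add_assoc] at this
          linarith
      -- Passing from `n` to `n + 1` changes the left side by `L 0 (n + N + 1) - L 0 n`, which is at
      -- most `L n (N + 1)`.
      have s2 : ∀ n, ∑ k ∈ Finset.range (N + 1), L 0 (n + k) ω ≤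
          ∑ i ∈ Finset.range n, L i (N + 1) ω + ∑ k ∈ Finset.range (N + 1), L 0 k ω := by
        intro n
        induction n with
        | zero => simp
        | succ n ih =>
          rw [Finset.sum_range_succ _ n]
          have e1 := Finset.sum_range_succ (fun k => L 0 (n + k) ω) (N + 1)
          have e2 := Finset.sum_range_succ' (fun k => L 0 (n + k) ω) (N + 1)
          have e3 : ∀ k, L 0 (n + 1 + k) ω = L 0 (n + (k + 1)) ω := fun k => by
            rw [add_assoc, add_comm 1 k]
          simp_rw [e3]
          have := h1 n (N + 1)
          simp only [add_zero] at e2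
          linarith
      have s3 : ((N + 1 : ℕ) : ℝ) * L 0 n ω ≤ ∑ i ∈ Finset.range n, L i (N + 1) ω + R n ω := by
        calc ((N + 1 : ℕ) : ℝ) * L 0 n ω = ∑ k ∈ Finset.range (N + 1), L 0 n ω := by
              rw [Finset.sum_const, Finset.card_range, nsmul_eq_mul]
          _ ≤ ∑ k ∈ Finset.range (N + 1), (L 0 (n + k) ω + ∑ j ∈ Finset.range k, W (n + j) ω) :=
              Finset.sum_le_sum fun k _ => s1 k
          _ ≤ _ := by
              rw [Finset.sum_add_distrib]
              have := s2 n
              have h4 : ∑ k ∈ Finset.range (N + 1), L 0 k ω ≤ ∑ k ∈ Finset.range (N + 1), |L 0 k ω| :=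
                Finset.sum_le_sum fun k _ => le_abs_self _
              simp only [hR]
              linarith
      set D := (∑ i ∈ Finset.range n, L i (N + 1) ω) / (n : ℝ) - u (N + 1) with hD
      have s4 : ∑ i ∈ Finset.range n, L i (N + 1) ω = n * (D + u (N + 1)) := by
        rw [hD]; field_simp; ring
      have s5 : L 0 n ω / n ≤ (|D| + u (N + 1) + R n ω / n) / ((N + 1 : ℕ) : ℝ) := by
        rw [le_div_iff₀ hNpos, div_mul_eq_mul_div, div_le_iff₀ hn', add_mul, div_mul_cancel₀ _ hn'.ne']
        rw [s4] at s3
        have := mul_le_mul_of_nonneg_left (le_abs_self D) hn'.le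
        linarith
      have s6 : (|D| + u (N + 1) + R n ω / n) / ((N + 1 : ℕ) : ℝ) ≤ |D| + (l + ε / 4) + R n ω / n := by
        rw [add_div, add_div]
        refine add_le_add (add_le_add (div_le_self (abs_nonneg _) hN1) hN)
          (div_le_self (by positivity) hN1)
      simp only [ha]
      linarith
    obtain ⟨n₁, hn₁⟩ := Metric.tendsto_atTop.1 (havg N) (ε / 4) (by positivity)
    have hKlim : Tendsto (fun n : ℕ => K / (n : ℝ)) atTop (𝓝 0) :=
      tendsto_const_nhds.div_atTop tendsto_natCast_atTop_atTop
    obtain ⟨n₂, hn₂⟩ := eventually_atTop.1 (hKlim.eventually_lt_const (show 0 < ε / 4 by positivity))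
    refine ⟨max n₁ n₂ + 1, fun n hn => ?_⟩
    have hn0 : 0 < n := by omega
    have hn' : (0 : ℝ) < n := Nat.cast_pos.2 hn0
    have t1 := hn₁ n (by omega)
    have t2 := hn₂ n (by omega)
    rw [Real.dist_0_eq_abs, abs_of_nonneg (integral_nonneg fun ω => abs_nonneg _)] at t1
    rw [Real.dist_0_eq_abs, abs_of_nonneg (integral_nonneg fun ω => le_max_right _ _)]
    have i1 := (integrable_average (fun i => hL i (N + 1)) (u (N + 1)) n).abs
    have i2 : Integrable (fun ω => |(∑ i ∈ Finset.range n, L i (N + 1) ω) / (n : ℝ) - u (N + 1)| +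
      ε / 4) P := i1.add (integrable_const _)
    calc ∫ ω, max (a n ω) 0 ∂P ≤ ∫ ω, (|(∑ i ∈ Finset.range n, L i (N + 1) ω) / (n : ℝ) - u (N + 1)|
          + ε / 4 + R n ω / n) ∂P :=
          integral_mono_ae (hap n) (i2.add ((hRi n).div_const _)) (key.mono fun ω h => h n hn0)
      _ = ∫ ω, |(∑ i ∈ Finset.range n, L i (N + 1) ω) / (n : ℝ) - u (N + 1)| ∂P + ε / 4 +
          (∫ ω, R n ω ∂P) / n := by
          rw [integral_add i2 ((hRi n).div_const _), integral_add i1 (integrable_const _),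
            integral_div (n : ℝ) (R n)]
          simp
      _ ≤ ε / 4 + ε / 4 + K / n := by
          refine add_le_add (add_le_add t1.le le_rfl) ?_
          exact div_le_div_of_nonneg_right (hRK n) hn'.le
      _ < ε := by linarith
  have hmeanlim : Tendsto (fun n : ℕ => ∫ ω, a n ω ∂P) atTop (𝓝 0) := by
    have := hlim.sub_const l
    rw [sub_self] at this
    refine this.congr fun n => ?_
    simp only [ha]
    rw [integral_sub ((hL 0 n).div_const _) (integrable_const _), integral_div]
    simp [hu]
  -- Here `|a| = 2 max a 0 - a`.
  have := (hpos.const_mul 2).sub hmeanlim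
  simp only [mul_zero, sub_zero] at this
  refine this.congr fun n => ?_
  rw [← integral_const_mul, ← integral_sub ((hap n).const_mul 2) (hai n)]
  refine integral_congr_ae (ae_of_all _ fun ω => ?_)
  simp only
  change 2 * max (a n ω) 0 - a n ω = |a n ω|
  rcases le_total (a n ω) 0 with h | h
  · rw [max_eq_right h, abs_of_nonpos h]; ring
  · rw [max_eq_left h, abs_of_nonneg h]; ring

/-- Markov's inequality. -/
theorem tendsto_measure_abs_sub_ge {L : ℕ → Ω → ℝ} {l : ℝ} (hL : ∀ n, Integrable (L n) P)
    (h : Tendsto (fun n : ℕ => ∫ ω, |L n ω / (n : ℝ) - l| ∂P) atTop (𝓝 0)) {ε : ℝ} (hε : 0 < ε) :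
    Tendsto (fun n : ℕ => P {ω | ε ≤ |L n ω / (n : ℝ) - l|}) atTop (𝓝 0) := by
  have h1 : Tendsto (fun n : ℕ => ENNReal.ofReal ((∫ ω, |L n ω / (n : ℝ) - l| ∂P) / ε)) atTop (𝓝 0) := by
    have := ENNReal.tendsto_ofReal (h.div_const ε)
    simpa using this
  refine tendsto_of_tendsto_of_tendsto_of_le_of_le tendsto_const_nhds h1 (fun _ => zero_le) fun n => ?_
  have := mul_meas_ge_le_integral_of_nonneg (ae_of_all P fun ω => abs_nonneg (L n ω / (n : ℝ) - l))
    (((hL n).div_const _).sub (integrable_const l)).abs ε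
  rw [← ofReal_measureReal (measure_ne_top _ _)]
  refine ENNReal.ofReal_le_ofReal ?_
  rw [le_div_iff₀ hε, mul_comm]
  exact this

end Subadditive

/-! ### Convergence of the normalized log-likelihood ratio -/

namespace IsErgodicSequence

variable {Ω 𝒵 : Type*} [MeasurableSpace Ω] [MeasurableSpace 𝒵] {P : Measure Ω} {Z : ℕ → Ω → 𝒵}

theorem identDistrib (hZ : IsErgodicSequence P Z) (i : ℕ) : IdentDistrib (Z i) (Z 0) P P := by
  refine ⟨(hZ.measurable i).aemeasurable, (hZ.measurable 0).aemeasurable, ?_⟩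
  have h := congrArg (Measure.map fun v : Fin 1 → 𝒵 => v 0) (hZ.map_shift 1 i)
  rw [Measure.map_map (measurable_pi_apply _) (measurable_obs (fun j => hZ.measurable _) _),
    Measure.map_map (measurable_pi_apply _) (measurable_obs hZ.measurable _)] at h
  exact h

end IsErgodicSequence

namespace HMMModel

variable {S 𝒵 Ω : Type*} [Fintype S] [MeasurableSpace 𝒵] [MeasurableSpace Ω] {ν : Measure 𝒵}
  (m : HMMModel S 𝒵 ν)

theorem measurableSet_regularObs : MeasurableSet m.regularObs := by
  have : m.regularObs = ⋂ x, (m.stateRatio x ⁻¹' {0}ᶜ ∩ m.stateRatio x ⁻¹' {∞}ᶜ) := by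
    ext z; simp [regularObs]
  rw [this]
  exact MeasurableSet.iInter fun x =>
    (m.measurable_stateRatio x (measurableSet_singleton 0).compl).inter
      (m.measurable_stateRatio x (measurableSet_singleton ∞).compl)

variable {m} {P : Measure Ω} {Z : ℕ → Ω → 𝒵}

theorem FiniteLogMoment.ae_all_mem (h : m.FiniteLogMoment P Z) (hZ : IsErgodicSequence P Z) :
    ∀ᵐ ω ∂P, ∀ i, Z i ω ∈ m.regularObs :=
  ae_all_iff.2 fun i => (hZ.identDistrib i).symm.ae_mem_snd m.measurableSet_regularObs
    (h.ae_mem (hZ.measurable 0))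

theorem FiniteLogMoment.integrable_logBound_of_ergodic (h : m.FiniteLogMoment P Z)
    (hZ : IsErgodicSequence P Z) (i : ℕ) : Integrable (fun ω => m.logBound (Z i ω)) P :=
  ((hZ.identDistrib i).comp m.measurable_logBound).integrable_iff.2
    (h.integrable_logBound (hZ.measurable 0))

theorem FiniteLogMoment.integrable_logLR (h : m.FiniteLogMoment P Z) (hZ : IsErgodicSequence P Z)
    (i n : ℕ) : Integrable (fun ω => m.logLR (obs (fun j => Z (i + j)) n ω)) P := by
  refine Integrable.mono' (integrable_finsetSum (Finset.range n) fun j _ =>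
    h.integrable_logBound_of_ergodic hZ (i + j)) ((m.measurable_logLR n).comp
      (measurable_obs (fun j => hZ.measurable _) n)).aestronglyMeasurable ?_
  filter_upwards [h.ae_all_mem hZ] with ω hω
  exact m.abs_logLR_le (z := fun j => Z (i + j) ω) (fun j => hω _) n

/-- The normalized log-likelihood ratio converges in mean. -/
theorem exists_isLogLikelihoodRate [IsProbabilityMeasure P] (hZ : IsErgodicSequence P Z)
    (hC : m.StationaryErgodicChain) (h : m.FiniteLogMoment P Z) :
    ∃ l, m.IsLogLikelihoodRate P Z l ∧
      Tendsto (fun n : ℕ => ∫ ω, |m.logLR (obs Z n ω) / (n : ℝ) - l| ∂P) atTop (𝓝 0) := by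
  obtain ⟨C, hC0, hC1⟩ := hC.exists_const
  have e0 : ∀ n, obs (fun j => Z (0 + j)) n = obs Z n := fun n => by simp only [zero_add]
  have hi := h.integrable_logLR hZ
  have hi0 : ∀ n, Integrable (fun ω => m.logLR (obs Z n ω)) P := fun n => by
    have := hi 0 n
    rwa [e0] at this
  have hW := h.integrable_logBound_of_ergodic hZ
  have hWw : ∀ i, ∫ ω, m.logBound (Z i ω) ∂P = ∫ ω, m.logBound (Z 0 ω) ∂P := fun i =>
    ((hZ.identDistrib i).comp m.measurable_logBound).integral_eq
  have hmean : ∀ i n, ∫ ω, m.logLR (obs (fun j => Z (i + j)) n ω) ∂P =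
      ∫ ω, m.logLR (obs Z n ω) ∂P := fun i n =>
    (IdentDistrib.comp ⟨(measurable_obs (fun j => hZ.measurable _) n).aemeasurable,
      (measurable_obs hZ.measurable n).aemeasurable, hZ.map_shift n i⟩ (m.measurable_logLR n)).integral_eq
  have hg := h.ae_all_mem hZ
  -- Adding `Real.log C` absorbs the constant of `logLR_add_le` and makes the sequence exactly
  -- subadditive; divided by `n`, the shift vanishes in the limit.
  have hlim := exists_tendsto_of_subadditive (P := P)
    (L := fun i n ω => m.logLR (obs (fun j => Z (i + j)) n ω) + Real.log C)
    (W := fun i ω => m.logBound (Z i ω)) (w := ∫ ω, m.logBound (Z 0 ω) ∂P) (c := -Real.log C)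
    (fun i n => (hi i n).add (integrable_const _)) hW (fun i ω => m.logBound_nonneg _)
    (fun i => (hWw i).le) ?_ ?_ ?_ ?_ ?_
  · obtain ⟨l, hl1, hl2⟩ := hlim
    simp only [e0] at hl1 hl2
    have hc : Tendsto (fun n : ℕ => Real.log C / (n : ℝ)) atTop (𝓝 0) :=
      tendsto_const_nhds.div_atTop tendsto_natCast_atTop_atTop
    refine ⟨l, ⟨hi0, ?_⟩, ?_⟩
    · have := hl1.sub hc
      rw [sub_zero] at this
      refine this.congr fun n => ?_
      rw [integral_add (hi0 n) (integrable_const _)]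
      simp only [integral_const, probReal_univ, one_smul]
      change _ = (∫ ω, m.logLR (obs Z n ω) ∂P) / n
      ring
    · have := hl2.add hc.abs
      rw [abs_zero, add_zero] at this
      refine squeeze_zero (fun n => integral_nonneg fun ω => abs_nonneg _) (fun n => ?_) this
      have i1 : Integrable (fun ω => |(m.logLR (obs Z n ω) + Real.log C) / (n : ℝ) - l|) P :=
        ((((hi0 n).add (integrable_const _)).div_const _).sub (integrable_const l)).abs
      calc _ ≤ ∫ ω, (|(m.logLR (obs Z n ω) + Real.log C) / (n : ℝ) - l| + |Real.log C / n|) ∂P := by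
            refine integral_mono (((hi0 n).div_const _).sub (integrable_const l)).abs
              (i1.add (integrable_const _)) fun ω => ?_
            have : m.logLR (obs Z n ω) / (n : ℝ) - l =
              ((m.logLR (obs Z n ω) + Real.log C) / (n : ℝ) - l) - Real.log C / n := by ring
            simp only
            rw [this]
            exact abs_sub _ _
        _ = _ := by rw [integral_add i1 (integrable_const _)]; simp
  · filter_upwards [hg] with ω hω n k
    have := m.logLR_add_le hC0 hC1 (z := fun j => Z j ω) hω n k
    simp only [e0]
    change m.logLR (fun i : Fin (n + k) => Z i ω) + _ ≤ m.logLR (fun i : Fin n => Z i ω) + _ +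
      (m.logLR (fun i : Fin k => Z (n + i) ω) + _)
    linarith
  · filter_upwards [hg] with ω hω n
    have := (m.logLR_succ_bounds (z := fun j => Z j ω) hω n).1
    simp only [e0]
    change m.logLR (fun i : Fin n => Z i ω) + _ ≤ m.logLR (fun i : Fin (n + 1) => Z i ω) + _ + _
    linarith
  · intro n
    simp only [e0]
    rw [integral_add (hi0 n) (integrable_const _)]
    have h1 : ∫ ω, -(∑ i ∈ Finset.range n, m.logBound (Z i ω)) ∂P ≤ ∫ ω, m.logLR (obs Z n ω) ∂P := by
      refine integral_mono_ae (integrable_finsetSum _ fun i _ => hW i).neg (hi0 n) ?_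
      filter_upwards [hg] with ω hω
      exact (abs_le.1 (m.abs_logLR_le (z := fun j => Z j ω) hω n)).1
    rw [integral_neg, integral_finsetSum _ fun i _ => hW i] at h1
    simp only [hWw, Finset.sum_const, Finset.card_range, nsmul_eq_mul] at h1
    simp only [integral_const, probReal_univ, one_smul]
    linarith
  · intro i n
    simp only [e0]
    rw [integral_add (hi i n) (integrable_const _), integral_add (hi0 n) (integrable_const _), hmean]
  · intro N
    have := hZ.average N (fun v => m.logLR v + Real.log C)
      ((m.measurable_logLR _).add measurable_const) ((hi0 _).add (integrable_const _))
    simp only [e0]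
    exact this

end HMMModel

/-! ### Signs of the limits through the Hellinger affinity -/

/-- Jensen's inequality for the exponential, obtained by integrating the tangent bound `g - c + 1 ≤
exp (g - c)`. -/
theorem integral_le_of_lintegral_exp_le {Ω : Type*} [MeasurableSpace Ω] {P : Measure Ω}
    [IsProbabilityMeasure P] {g : Ω → ℝ} (hg : Integrable g P) {c : ℝ}
    (h : ∫⁻ ω, ENNReal.ofReal (Real.exp (g ω)) ∂P ≤ ENNReal.ofReal (Real.exp c)) :
    ∫ ω, g ω ∂P ≤ c := by
  have hm : AEStronglyMeasurable (fun ω => Real.exp (g ω)) P :=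
    Real.continuous_exp.comp_aestronglyMeasurable hg.aestronglyMeasurable
  have h0 : 0 ≤ᵐ[P] fun ω => Real.exp (g ω) := ae_of_all _ fun ω => (Real.exp_pos _).le
  have hi : Integrable (fun ω => Real.exp (g ω)) P :=
    (lintegral_ofReal_ne_top_iff_integrable hm h0).1 (h.trans_lt ENNReal.ofReal_lt_top).ne
  rw [← ofReal_integral_eq_lintegral_ofReal hi h0, ENNReal.ofReal_le_ofReal_iff (Real.exp_pos _).le] at h
  have h1 : ∫ ω, (g ω - c + 1) ∂P ≤ ∫ ω, Real.exp (g ω) * Real.exp (-c) ∂P := by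
    refine integral_mono ((hg.sub (integrable_const _)).add (integrable_const _)) (hi.mul_const _)
      fun ω => ?_
    simp only
    rw [← Real.exp_add, ← sub_eq_add_neg]
    exact Real.add_one_le_exp _
  rw [integral_mul_const] at h1
  have i1 : Integrable (fun ω => g ω - c) P := hg.sub (integrable_const _)
  rw [integral_add i1 (integrable_const _), integral_sub hg (integrable_const _)] at h1
  simp only [integral_const, probReal_univ, one_smul] at h1
  have h2 := mul_le_mul_of_nonneg_right h (Real.exp_pos (-c)).le
  rw [← Real.exp_add c, add_neg_cancel, Real.exp_zero] at h2
  linarith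

namespace HMMModel

variable {S 𝒵 Ω : Type*} [Fintype S] [MeasurableSpace 𝒵] [MeasurableSpace Ω] {ν : Measure 𝒵}
  (m : HMMModel S 𝒵 ν)

/-- An inequality only, because the mass that `f x` may have where `f₀` vanishes is lost. -/
theorem lintegral_stateRatio_le (x : S) :
    ∫⁻ z, m.stateRatio x z ∂(ν.withDensity m.f₀) ≤ 1 := by
  rw [lintegral_withDensity_eq_lintegral_mul _ m.measurable_f₀ (m.measurable_stateRatio x),
    ← m.lintegral_f x]
  exact lintegral_mono fun z => ENNReal.mul_div_le

/-- The Hellinger affinity of the noise density and of a mixture of the state densities. -/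
noncomputable def affinity (p : S → ℝ) : ℝ :=
  ∫ z, √(∑ x, p x * (m.stateRatio x z).toReal) ∂(ν.withDensity m.f₀)

theorem integrable_toReal_stateRatio (x : S) :
    Integrable (fun z => (m.stateRatio x z).toReal) (ν.withDensity m.f₀) :=
  integrable_toReal_of_lintegral_ne_top (m.measurable_stateRatio x).aemeasurable
    ((m.lintegral_stateRatio_le x).trans_lt ENNReal.one_lt_top).ne

theorem measurable_sqrt_mixture (p : S → ℝ) :
    Measurable fun z => √(∑ x, p x * (m.stateRatio x z).toReal) :=
  Real.continuous_sqrt.measurable.comp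
    (Finset.measurable_sum _ fun x _ => (m.measurable_stateRatio x).ennreal_toReal.const_mul _)

theorem sqrt_mixture_le {p : S → ℝ} (hp : p ∈ stdSimplex ℝ S) (z : 𝒵) :
    √(∑ x, p x * (m.stateRatio x z).toReal) ≤ 1 + ∑ x, (m.stateRatio x z).toReal := by
  have h1 : ∑ x, p x * (m.stateRatio x z).toReal ≤ ∑ x, (m.stateRatio x z).toReal := by
    refine Finset.sum_le_sum fun x _ => mul_le_of_le_one_left ENNReal.toReal_nonneg ?_
    rw [← hp.2]
    exact Finset.single_le_sum (f := p) (fun y _ => hp.1 y) (Finset.mem_univ x)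
  have h0 : 0 ≤ ∑ x, (m.stateRatio x z).toReal := Finset.sum_nonneg fun _ _ => ENNReal.toReal_nonneg
  rw [Real.sqrt_le_left (by linarith)]
  nlinarith

theorem integrable_sqrt_mixture {p : S → ℝ} (hp : p ∈ stdSimplex ℝ S) :
    Integrable (fun z => √(∑ x, p x * (m.stateRatio x z).toReal)) (ν.withDensity m.f₀) := by
  refine Integrable.mono' ((integrable_const 1).add (integrable_finsetSum Finset.univ fun x _ =>
    m.integrable_toReal_stateRatio x)) (m.measurable_sqrt_mixture p).aestronglyMeasurable
    (ae_of_all _ fun z => ?_)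
  rw [Real.norm_of_nonneg (Real.sqrt_nonneg _)]
  exact m.sqrt_mixture_le hp z

theorem continuousOn_affinity : ContinuousOn m.affinity (stdSimplex ℝ S) := by
  refine continuousOn_of_dominated (bound := fun z => 1 + ∑ x, (m.stateRatio x z).toReal)
    (fun p _ => (m.measurable_sqrt_mixture p).aestronglyMeasurable)
    (fun p hp => ae_of_all _ fun z => ?_)
    ((integrable_const 1).add (integrable_finsetSum _ fun x _ => m.integrable_toReal_stateRatio x))
    (ae_of_all _ fun z => ?_)
  · rw [Real.norm_of_nonneg (Real.sqrt_nonneg _)]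
    exact m.sqrt_mixture_le hp z
  · exact (by fun_prop : Continuous fun p : S → ℝ =>
      √(∑ x, p x * (m.stateRatio x z).toReal)).continuousOn

variable {m}

/-- If the affinity were at least `1`, then `∫ (1 - √h)² = 1 - 2 ∫ √h + ∫ h ≤ 0` for the mixture
ratio `h`, whose integral is at most `1`. Hence `h = 1` almost everywhere under the noise law, and
the mixture would equal `f₀`. -/
theorem NoiseNotMixture.affinity_lt_one (hN : m.NoiseNotMixture)
    (hreg : ∀ᵐ z ∂(ν.withDensity m.f₀), z ∈ m.regularObs) {p : S → ℝ} (hp : p ∈ stdSimplex ℝ S) :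
    m.affinity p < 1 := by
  by_contra! hge
  set μ := ν.withDensity m.f₀ with hμ
  set h : 𝒵 → ℝ := fun z => ∑ x, p x * (m.stateRatio x z).toReal with hh
  have hh0 : ∀ z, 0 ≤ h z := fun z =>
    Finset.sum_nonneg fun x _ => mul_nonneg (hp.1 x) ENNReal.toReal_nonneg
  have hi : Integrable h μ :=
    integrable_finsetSum _ fun x _ => (m.integrable_toReal_stateRatio x).const_mul _
  have his := m.integrable_sqrt_mixture hp
  have hint : ∫ z, h z ∂μ ≤ 1 := by
    simp only [hh]
    rw [integral_finsetSum _ fun x _ => (m.integrable_toReal_stateRatio x).const_mul _, ← hp.2]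
    refine Finset.sum_le_sum fun x _ => ?_
    rw [integral_const_mul]
    refine mul_le_of_le_one_right (hp.1 x) ?_
    rw [integral_toReal (m.measurable_stateRatio x).aemeasurable
      (hreg.mono fun z hz => (hz x).2.lt_top)]
    exact ENNReal.toReal_le_of_le_ofReal zero_le_one (by simpa using m.lintegral_stateRatio_le x)
  have e : ∀ z, (1 - √(h z)) ^ 2 = 1 - 2 * √(h z) + h z := fun z => by
    have := Real.sq_sqrt (hh0 z)
    nlinarith
  have i1 : Integrable (fun z => 1 - 2 * √(h z)) μ := (integrable_const 1).sub (his.const_mul 2)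
  have hi2 : Integrable (fun z => (1 - √(h z)) ^ 2) μ := by
    simp_rw [e]
    exact i1.add hi
  have h0 : ∫ z, (1 - √(h z)) ^ 2 ∂μ = 0 := by
    refine le_antisymm ?_ (integral_nonneg fun z => sq_nonneg _)
    simp_rw [e]
    rw [integral_add i1 hi, integral_sub (integrable_const 1) (his.const_mul 2), integral_const_mul]
    have : 1 ≤ ∫ z, √(h z) ∂μ := hge
    simp only [integral_const, probReal_univ, one_smul]
    linarith
  have h1 : ∀ᵐ z ∂μ, h z = 1 := by
    filter_upwards [(integral_eq_zero_iff_of_nonneg (fun z => sq_nonneg _) hi2).1 h0] with z hz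
    have hz' : 1 - √(h z) = 0 := pow_eq_zero_iff (two_ne_zero) |>.1 hz
    have : √(h z) = 1 := by linarith
    rw [← Real.sq_sqrt (hh0 z), this, one_pow]
  have hp1 : ∑ x, ENNReal.ofReal (p x) = 1 := by
    rw [← ENNReal.ofReal_sum_of_nonneg fun x _ => hp.1 x, hp.2, ENNReal.ofReal_one]
  refine hN (PMF.ofFintype (fun x => ENNReal.ofReal (p x)) hp1) ?_
  simp only [PMF.ofFintype_apply]
  have hm : Measurable fun z => ∑ x, ENNReal.ofReal (p x) * m.f x z :=
    Finset.measurable_sum _ fun x _ => (m.measurable_f x).const_mul _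
  symm
  -- The ratio says nothing where `f₀ = 0`. There only `f₀ ≤` mixture is clear, and the comparison
  -- of total masses upgrades it to equality.
  refine ae_eq_of_ae_le_of_lintegral_le ?_ (by rw [m.lintegral_f₀]; exact ENNReal.one_ne_top)
    hm.aemeasurable ?_
  · have h2 := (ae_withDensity_iff m.measurable_f₀).1 (h1.and hreg)
    filter_upwards [h2] with z hz
    by_cases hz0 : m.f₀ z = 0
    · rw [hz0]; exact zero_le
    · obtain ⟨hz1, hzr⟩ := hz hz0
      have e1 : ∑ x, ENNReal.ofReal (p x) * m.stateRatio x z = 1 := by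
        rw [← ENNReal.ofReal_one, ← hz1]
        simp only [hh]
        rw [ENNReal.ofReal_sum_of_nonneg fun x _ => mul_nonneg (hp.1 x) ENNReal.toReal_nonneg]
        refine Finset.sum_congr rfl fun x _ => ?_
        rw [ENNReal.ofReal_mul (hp.1 x), ENNReal.ofReal_toReal (hzr x).2]
      refine le_of_eq ?_
      calc m.f₀ z = m.f₀ z * ∑ x, ENNReal.ofReal (p x) * m.stateRatio x z := by rw [e1, mul_one]
        _ = _ := by
          rw [Finset.mul_sum]
          refine Finset.sum_congr rfl fun x _ => ?_
          unfold stateRatio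
          rw [mul_left_comm, ENNReal.mul_div_cancel hz0 (m.noise_ne_top_of_mem_regularObs hzr)]
  · rw [lintegral_finsetSum _ fun x _ => (m.measurable_f x).const_mul _, m.lintegral_f₀]
    simp_rw [lintegral_const_mul _ (m.measurable_f _), m.lintegral_f, mul_one]
    exact hp1.le

/-- The Hellinger affinity of the noise density and of the mixtures is bounded away from `1`. -/
theorem NoiseNotMixture.exists_affinity_bound (hN : m.NoiseNotMixture)
    (hreg : ∀ᵐ z ∂(ν.withDensity m.f₀), z ∈ m.regularObs) :
    ∃ ρ : ℝ, 0 < ρ ∧ ρ < 1 ∧ ∀ q : S → ℝ≥0∞,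
      ∫⁻ z, (∑ x, q x * m.stateRatio x z) ^ (1 / 2 : ℝ) ∂(ν.withDensity m.f₀) ≤
        ENNReal.ofReal ρ * (∑ x, q x) ^ (1 / 2 : ℝ) := by
  classical
  have hne : (stdSimplex ℝ S).Nonempty := by
    obtain ⟨x, -⟩ := m.init.support_nonempty
    exact ⟨Pi.single x 1, single_mem_stdSimplex ℝ x⟩
  obtain ⟨p₀, hp₀, hmax⟩ := (isCompact_stdSimplex ℝ S).exists_isMaxOn hne m.continuousOn_affinity
  -- The maximum with `1 / 2` keeps `ρ` positive, so that its powers can be written as exponentials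
  -- of `Real.log ρ`.
  refine ⟨max (m.affinity p₀) (1 / 2), by positivity,
    max_lt (hN.affinity_lt_one hreg hp₀) (by norm_num), fun q => ?_⟩
  set ρ := max (m.affinity p₀) (1 / 2)
  have hρ : 0 < ρ := lt_of_lt_of_le (by norm_num) (le_max_right _ _)
  set s := ∑ x, q x with hs
  rcases eq_or_ne s 0 with h0 | h0
  · have hq : ∀ x, q x = 0 := fun x => (Finset.sum_eq_zero_iff.1 h0) x (Finset.mem_univ x)
    simp [hq]
  rcases eq_or_ne s ∞ with h1 | h1
  · rw [h1, ENNReal.top_rpow_of_pos (by norm_num), ENNReal.mul_top]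
    · exact le_top
    · simpa using hρ
  have hq : ∀ x, q x ≠ ∞ := fun x => ENNReal.sum_ne_top.1 h1 x (Finset.mem_univ x)
  have hqs : ∀ x, q x / s ≠ ∞ := fun x => ENNReal.div_ne_top (hq x) h0
  set p : S → ℝ := fun x => (q x / s).toReal with hp
  have hps : p ∈ stdSimplex ℝ S := by
    refine ⟨fun x => ENNReal.toReal_nonneg, ?_⟩
    simp only [hp]
    rw [← ENNReal.toReal_sum fun x _ => hqs x]
    simp_rw [div_eq_mul_inv]
    rw [← Finset.sum_mul, ← hs, ENNReal.mul_inv_cancel h0 h1, ENNReal.toReal_one]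
  have e : ∀ᵐ z ∂(ν.withDensity m.f₀), (∑ x, q x * m.stateRatio x z) ^ (1 / 2 : ℝ) =
      s ^ (1 / 2 : ℝ) * ENNReal.ofReal √(∑ x, p x * (m.stateRatio x z).toReal) := by
    filter_upwards [hreg] with z hz
    have e1 : ∑ x, q x * m.stateRatio x z =
        s * ENNReal.ofReal (∑ x, p x * (m.stateRatio x z).toReal) := by
      rw [ENNReal.ofReal_sum_of_nonneg fun x _ =>
        mul_nonneg ENNReal.toReal_nonneg ENNReal.toReal_nonneg, Finset.mul_sum]
      refine Finset.sum_congr rfl fun x _ => ?_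
      rw [ENNReal.ofReal_mul ENNReal.toReal_nonneg, ENNReal.ofReal_toReal (hz x).2,
        ENNReal.ofReal_toReal (hqs x), ← mul_assoc, ENNReal.mul_div_cancel h0 h1]
    rw [e1, ENNReal.mul_rpow_of_nonneg _ _ (by norm_num), ENNReal.ofReal_rpow_of_nonneg
      (Finset.sum_nonneg fun x _ => mul_nonneg ENNReal.toReal_nonneg ENNReal.toReal_nonneg)
      (by norm_num), Real.sqrt_eq_rpow]
  rw [lintegral_congr_ae e, lintegral_const_mul _ (m.measurable_sqrt_mixture p).ennreal_ofReal,
    ← ofReal_integral_eq_lintegral_ofReal (m.integrable_sqrt_mixture hps)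
      (ae_of_all _ fun z => Real.sqrt_nonneg _), mul_comm]
  gcongr
  exact (hmax hps).trans (le_max_left _ _)

theorem IsNoise.ae_mem_regularObs {P : Measure Ω} {Z : ℕ → Ω → 𝒵} (h : m.IsNoise P Z)
    (hF : m.FiniteLogMoment P Z) : ∀ᵐ z ∂(ν.withDensity m.f₀), z ∈ m.regularObs := by
  rw [← h.2.2 0]
  exact (ae_map_iff (h.1 0).aemeasurable m.measurableSet_regularObs).2 (hF.ae_mem (h.1 0))

/-- The weights `q` depend on the first `n` observations only, so the likelihood ratio is linear in
the state ratios of the next one. The pointwise lemmas need an infinite regular sequence, obtained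
by repeating `z'` after time `n`; this is why a regular observation must exist for the first claim.
-/
theorem likelihoodRatio_snoc (n : ℕ) (z : Fin n → 𝒵) (hz : ∀ i, z i ∈ m.regularObs) :
    ∃ q : S → ℝ≥0∞, (m.regularObs.Nonempty → ∑ y, q y = m.likelihoodRatio z) ∧
      ∀ z' ∈ m.regularObs, m.likelihoodRatio (Fin.snoc (α := fun _ => 𝒵) z z') =
        ∑ y, q y * m.stateRatio y z' := by
  set e : 𝒵 → ℕ → 𝒵 := fun z' i => if h : i < n then z ⟨i, h⟩ else z' with he
  have her : ∀ z' ∈ m.regularObs, ∀ i, e z' i ∈ m.regularObs := fun z' hz' i => by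
    simp only [he]
    split_ifs
    · exact hz _
    · exact hz'
  set w : ℕ → S → ℝ≥0∞ := fun i x => if h : i < n then m.stateRatio x (z ⟨i, h⟩) else 1 with hw
  have hq : ∀ z' y, m.forwardWeight (fun i x => m.stateRatio x (e z' i)) n y =
      m.forwardWeight w n y := fun z' y =>
    m.forwardWeight_congr n (fun i hi => by funext x; simp [he, hw, hi]) y
  refine ⟨m.forwardWeight w n, fun ⟨z', hz'⟩ => ?_, fun z' hz' => ?_⟩
  · have h := m.likelihoodRatio_eq_sum (her z' hz') n
    simp only [hq] at h
    rw [← h]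
    congr 1
    funext i
    simp [he]
  · have h := m.likelihoodRatio_succ_eq_sum (her z' hz') n
    simp only [hq] at h
    have e1 : (fun i : Fin (n + 1) => e z' i) = Fin.snoc (α := fun _ => 𝒵) z z' := by
      funext i
      refine Fin.lastCases ?_ (fun j => ?_) i <;> simp [he]
    have e2 : e z' n = z' := by simp [he]
    rw [e1, e2] at h
    exact h

/-- Under noise the next observation is independent of the past, so integrating it out first gains a
factor `ρ` at each step. -/
theorem IsNoise.lintegral_sqrt_likelihoodRatio_le {P : Measure Ω} [IsProbabilityMeasure P]
    {Z : ℕ → Ω → 𝒵} (h : m.IsNoise P Z)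
    (hreg : ∀ᵐ z ∂(ν.withDensity m.f₀), z ∈ m.regularObs) {ρ : ℝ≥0∞}
    (hρ : ∀ q : S → ℝ≥0∞,
      ∫⁻ z, (∑ x, q x * m.stateRatio x z) ^ (1 / 2 : ℝ) ∂(ν.withDensity m.f₀) ≤
        ρ * (∑ x, q x) ^ (1 / 2 : ℝ)) (n : ℕ) :
    ∫⁻ ω, (m.likelihoodRatio (obs Z n ω)) ^ (1 / 2 : ℝ) ∂P ≤ ρ ^ n := by
  set μ := ν.withDensity m.f₀
  have hm : ∀ k, Measurable fun z : Fin k → 𝒵 => (m.likelihoodRatio z) ^ (1 / 2 : ℝ) := fun k =>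
    (m.measurable_likelihoodRatio k).pow_const _
  have hne : m.regularObs.Nonempty := hreg.exists
  rw [← lintegral_map (hm n) (measurable_obs h.1 n), h.map_obs]
  induction n with
  | zero =>
    simp only [likelihoodRatio_zero, ENNReal.one_rpow, pow_zero]
    simp
  | succ n ih =>
    rw [lintegral_pi_succ _ _ (hm _)]
    have hr : ∀ᵐ z ∂(Measure.pi fun _ : Fin n => μ), ∀ i, z i ∈ m.regularObs :=
      ae_all_iff.2 fun i => (Measure.quasiMeasurePreserving_eval (fun _ : Fin n => μ) i).ae hreg
    calc _ ≤ ∫⁻ z, ρ * (m.likelihoodRatio z) ^ (1 / 2 : ℝ) ∂(Measure.pi fun _ : Fin n => μ) := by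
          refine lintegral_mono_ae ?_
          filter_upwards [hr] with z hz
          obtain ⟨q, hq1, hq2⟩ := m.likelihoodRatio_snoc n z hz
          rw [← hq1 hne]
          refine le_trans (le_of_eq ?_) (hρ q)
          refine lintegral_congr_ae ?_
          filter_upwards [hreg] with z' hz'
          rw [hq2 z' hz']
      _ = ρ * ∫⁻ z, (m.likelihoodRatio z) ^ (1 / 2 : ℝ) ∂(Measure.pi fun _ : Fin n => μ) :=
          lintegral_const_mul _ (hm n)
      _ ≤ ρ * ρ ^ n := by gcongr
      _ = ρ ^ (n + 1) := (pow_succ' _ _).symm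

variable [MeasurableSpace S] [DiscreteMeasurableSpace S] [SigmaFinite ν] {P₀ P₁ : Measure Ω}
  {X : ℕ → Ω → S} {Z : ℕ → Ω → 𝒵}

/-- Absolute continuity of the signal with respect to the noise. The first observation is almost
surely regular under `P₁` and every state has positive initial probability, so no `f x` has mass off
the regular observations, where `f₀ = 0` lies. -/
theorem IsSignal.ae_zero_of_noise_zero (h : m.IsSignal P₁ X Z) (hC : m.StationaryErgodicChain)
    (hF : m.FiniteLogMoment P₁ Z) : ∀ᵐ z ∂ν, m.f₀ z = 0 → ∀ x, m.f x z = 0 := by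
  have hm : Measurable fun e : S × 𝒵 => (m.regularObsᶜ).indicator (1 : 𝒵 → ℝ≥0∞) e.2 :=
    (measurable_one.indicator m.measurableSet_regularObs.compl).comp measurable_snd
  have h1 : ∫⁻ ω, (m.regularObsᶜ).indicator (1 : 𝒵 → ℝ≥0∞) (Z 0 ω) ∂P₁ = 0 := by
    rw [← lintegral_zero (μ := P₁)]
    refine lintegral_congr_ae ?_
    filter_upwards [hF.ae_mem (h.2.1 0)] with ω hω
    simp [hω]
  have h2 := lintegral_map (μ := P₁) hm ((h.1 0).prodMk (h.2.1 0))
  rw [h.map_zero, m.lintegral_stateObsLaw _ hm] at h2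
  simp only at h2
  rw [h1] at h2
  suffices h : ∀ x, ∀ᵐ z ∂ν, m.f₀ z = 0 → m.f x z = 0 from
    (ae_all_iff.2 h).mono fun z hz h0 x => hz x h0
  intro x
  have h3 := (Finset.sum_eq_zero_iff.1 h2) x (Finset.mem_univ x)
  have h4 := (mul_eq_zero.1 h3).resolve_left (hC.init_pos x).ne'
  have hm2 : Measurable fun z => m.f x z * (m.regularObsᶜ).indicator (1 : 𝒵 → ℝ≥0∞) z :=
    (m.measurable_f x).mul (measurable_one.indicator m.measurableSet_regularObs.compl)
  rw [lintegral_eq_zero_iff hm2] at h4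
  filter_upwards [h4] with z hz h0
  have hnr : z ∈ m.regularObsᶜ := fun hr => m.noise_ne_zero_of_mem_regularObs hr h0
  simpa [hnr] using hz

/-- The likelihood ratio is the density of the law of the observations under the alternative with
respect to their law under the hypothesis. -/
theorem lintegral_signal_eq [IsProbabilityMeasure P₀] (h₀ : m.IsNoise P₀ Z)
    (h₁ : m.IsSignal P₁ X Z) (hC : m.StationaryErgodicChain) (hF : m.FiniteLogMoment P₁ Z) (k : ℕ)
    {F : (Fin k → 𝒵) → ℝ≥0∞} (hFm : Measurable F) :
    ∫⁻ ω, F (obs Z k ω) ∂P₁ =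
      ∫⁻ ω, m.likelihoodRatio (obs Z k ω) * F (obs Z k ω) ∂P₀ := by
  have e0 := h₀.lintegral_obs k ((m.measurable_likelihoodRatio k).mul hFm)
  refine (h₁.lintegral_obs k fun _ => hFm).trans (Eq.trans ?_ e0.symm)
  have hms : ∀ x : Fin k → S, Measurable fun z : Fin k → 𝒵 => m.condDensity x z * F z := fun x =>
    (m.measurable_condDensity x).mul hFm
  rw [Finset.sum_congr rfl fun x _ => (lintegral_const_mul (m.pathProb k x) (hms x)).symm]
  rw [← lintegral_finsetSum _ fun x _ => (hms x).const_mul _]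
  refine lintegral_congr_ae ?_
  have hfin : ∀ᵐ z ∂ν, m.f₀ z < ∞ :=
    ae_lt_top m.measurable_f₀ (by rw [m.lintegral_f₀]; exact ENNReal.one_ne_top)
  have hall : ∀ᵐ z ∂(Measure.pi fun _ : Fin k => ν), ∀ i, m.f₀ (z i) < ∞ ∧
      (m.f₀ (z i) = 0 → ∀ x, m.f x (z i) = 0) :=
    ae_all_iff.2 fun i => (Measure.quasiMeasurePreserving_eval (fun _ : Fin k => ν) i).ae
      (hfin.and (h₁.ae_zero_of_noise_zero hC hF))
  filter_upwards [hall] with z hz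
  change ∑ x, _ = m.noiseDensity z * (m.likelihoodRatio z * F z)
  unfold likelihoodRatio
  rw [← mul_assoc, Finset.mul_sum, Finset.sum_mul]
  refine Finset.sum_congr rfl fun x _ => ?_
  rw [← mul_assoc]
  congr 1
  rw [mul_left_comm]
  congr 1
  -- If the noise density vanishes, so does the conditional density, and both sides are `0` whatever
  -- the conventional value of the quotient.
  by_cases h0 : ∃ i, m.f₀ (z i) = 0
  · obtain ⟨i, hi⟩ := h0
    have h1 : m.condDensity x z = 0 := Finset.prod_eq_zero (Finset.mem_univ i) ((hz i).2 hi _)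
    rw [h1]; simp
  · push Not at h0
    rw [ENNReal.mul_div_cancel]
    · exact Finset.prod_ne_zero_iff.2 fun i _ => h0 i
    · exact ENNReal.prod_ne_top fun i _ => (hz i).1.ne

/-- The normalized log-likelihood ratio has a negative limit under the hypothesis and a positive
limit under the alternative. -/
theorem rate_neg_and_rate_pos [IsProbabilityMeasure P₀] [IsProbabilityMeasure P₁]
    (h₀ : m.IsNoise P₀ Z) (h₁ : m.IsSignal P₁ X Z) (hC : m.StationaryErgodicChain)
    (hN : m.NoiseNotMixture) (hF₀ : m.FiniteLogMoment P₀ Z) (hF₁ : m.FiniteLogMoment P₁ Z)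
    {l₀ l₁ : ℝ} (hl₀ : m.IsLogLikelihoodRate P₀ Z l₀) (hl₁ : m.IsLogLikelihoodRate P₁ Z l₁) :
    l₀ < 0 ∧ 0 < l₁ := by
  have hreg := h₀.ae_mem_regularObs hF₀
  obtain ⟨ρ, hρ0, hρ1, hρ⟩ := hN.exists_affinity_bound hreg
  have hB := h₀.lintegral_sqrt_likelihoodRatio_le hreg hρ
  have hlog : Real.log ρ < 0 := Real.log_neg hρ0 hρ1
  have hpow : ∀ n : ℕ, ENNReal.ofReal ρ ^ n = ENNReal.ofReal (Real.exp (n * Real.log ρ)) := by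
    intro n
    rw [← ENNReal.ofReal_pow hρ0.le, Real.exp_nat_mul, Real.exp_log hρ0]
  have hr₀ := hF₀.ae_all_mem h₀.isErgodicSequence
  have hr₁ := hF₁.ae_all_mem (h₁.isErgodicSequence hC)
  have b₀ : ∀ n : ℕ, ∫ ω, m.logLR (obs Z n ω) / 2 ∂P₀ ≤ n * Real.log ρ := by
    intro n
    refine integral_le_of_lintegral_exp_le ((hl₀.1 n).div_const 2) ?_
    rw [← hpow]
    refine le_trans (le_of_eq (lintegral_congr_ae ?_)) (hB n)
    filter_upwards [hr₀] with ω hω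
    have := m.likelihoodRatio_eq_exp (z := fun i => Z i ω) hω n
    change _ = (m.likelihoodRatio fun i : Fin n => Z i ω) ^ _
    rw [this, ENNReal.ofReal_rpow_of_nonneg (Real.exp_pos _).le (by norm_num), ← Real.exp_mul]
    congr 2
    exact div_eq_mul_one_div _ _
  -- The change of measure turns `E₁[Λ^{-1/2}]` into `E₀[Λ · Λ^{-1/2}] = E₀[Λ^{1/2}]`, so the same
  -- bound applies.
  have b₁ : ∀ n : ℕ, ∫ ω, -m.logLR (obs Z n ω) / 2 ∂P₁ ≤ n * Real.log ρ := by
    intro n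
    have hi : Integrable (fun ω => -m.logLR (obs Z n ω) / 2) P₁ := (hl₁.1 n).neg.div_const 2
    refine integral_le_of_lintegral_exp_le hi ?_
    rw [← hpow]
    have hm : Measurable fun z : Fin n → 𝒵 => ENNReal.ofReal (Real.exp (-m.logLR z / 2)) :=
      (Real.measurable_exp.comp ((m.measurable_logLR n).neg.div_const 2)).ennreal_ofReal
    rw [lintegral_signal_eq h₀ h₁ hC hF₁ n hm]
    refine le_trans (le_of_eq (lintegral_congr_ae ?_)) (hB n)
    filter_upwards [hr₀] with ω hω
    have := m.likelihoodRatio_eq_exp (z := fun i => Z i ω) hω n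
    change (m.likelihoodRatio fun i : Fin n => Z i ω) * ENNReal.ofReal
      (Real.exp (-m.logLR (fun i : Fin n => Z i ω) / 2)) = (m.likelihoodRatio fun i : Fin n => Z i ω) ^ _
    rw [this, ENNReal.ofReal_rpow_of_nonneg (Real.exp_pos _).le (by norm_num), ← Real.exp_mul,
      ← ENNReal.ofReal_mul (Real.exp_pos _).le, ← Real.exp_add]
    congr 2
    ring
  constructor
  · refine lt_of_le_of_lt (le_of_tendsto hl₀.2 ((eventually_gt_atTop 0).mono fun n hn => ?_))
      (by linarith : 2 * Real.log ρ < 0)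
    have hn' : (0 : ℝ) < n := Nat.cast_pos.2 hn
    have := b₀ n
    rw [integral_div] at this
    change (∫ ω, m.logLR (obs Z n ω) ∂P₀) / n ≤ _
    rw [div_le_iff₀ hn']
    linarith
  · refine lt_of_lt_of_le (by linarith : 0 < -(2 * Real.log ρ))
      (ge_of_tendsto hl₁.2 ((eventually_gt_atTop 0).mono fun n hn => ?_))
    have hn' : (0 : ℝ) < n := Nat.cast_pos.2 hn
    have := b₁ n
    rw [integral_div, integral_neg] at this
    change _ ≤ (∫ ω, m.logLR (obs Z n ω) ∂P₁) / n
    rw [le_div_iff₀ hn']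
    linarith

end HMMModel

/-! ### Stopping times and change of measure -/

namespace SeqTest

variable {𝒵 Ω : Type*} [MeasurableSpace 𝒵] (T : SeqTest 𝒵) (Z : ℕ → Ω → 𝒵)

theorem time_le_iff (n : ℕ) (ω : Ω) :
    T.time Z ω ≤ n ↔ ∃ k, k ≤ n ∧ 1 ≤ k ∧ obs Z k ω ∈ T.stopSet k := by
  constructor
  · intro h
    by_contra! hn
    have : ((n + 1 : ℕ) : ℕ∞) ≤ T.time Z ω := by
      refine le_iInf₂ fun k hk => Nat.cast_le.2 ?_
      by_contra! hkn
      exact hn k (by omega) hk.1 hk.2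
    have h2 := this.trans h
    rw [Nat.cast_le] at h2
    omega
  · rintro ⟨k, hkn, hk⟩
    exact (iInf₂_le k hk).trans (Nat.cast_le.2 hkn)

/-- The events that depend only on the first `n` observations. -/
theorem measurableSet_comap_obs {k n : ℕ} (hkn : k ≤ n) {C : Set (Fin k → 𝒵)} (hC : MeasurableSet C) :
    MeasurableSet[MeasurableSpace.comap (obs Z n) inferInstance] {ω | obs Z k ω ∈ C} := by
  refine ⟨(fun v : Fin n → 𝒵 => fun i : Fin k => v (Fin.castLE hkn i)) ⁻¹' C,
    measurable_pi_lambda _ (fun i => measurable_pi_apply _) hC, rfl⟩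

theorem measurableSet_time_le {k n : ℕ} (hkn : k ≤ n) :
    MeasurableSet[MeasurableSpace.comap (obs Z n) inferInstance] {ω | T.time Z ω ≤ k} := by
  have : {ω | T.time Z ω ≤ k} =
      ⋃ j, ⋃ (_ : j ≤ k), ⋃ (_ : 1 ≤ j), {ω | obs Z j ω ∈ T.stopSet j} := by
    ext ω
    simp only [mem_ofPred_eq, time_le_iff, mem_iUnion, exists_prop]
  rw [this]
  exact MeasurableSet.iUnion fun j => MeasurableSet.iUnion fun hj => MeasurableSet.iUnion fun _ =>
    measurableSet_comap_obs Z (hj.trans hkn) (T.measurableSet_stopSet j)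

theorem measurableSet_time_eq {k n : ℕ} (hkn : k ≤ n) :
    MeasurableSet[MeasurableSpace.comap (obs Z n) inferInstance] {ω | T.time Z ω = k} := by
  cases k with
  | zero =>
    have : {ω | T.time Z ω = (0 : ℕ)} = {ω | T.time Z ω ≤ (0 : ℕ)} := by
      ext ω; simp
    rw [this]
    exact T.measurableSet_time_le Z hkn
  | succ k =>
    have : {ω | T.time Z ω = (k + 1 : ℕ)} = {ω | T.time Z ω ≤ (k + 1 : ℕ)} \ {ω | T.time Z ω ≤ k} := by
      ext ω
      simp only [mem_ofPred_eq, Set.mem_sdiff, not_le]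
      constructor
      · intro h
        rw [h]
        exact ⟨le_rfl, Nat.cast_lt.2 (Nat.lt_succ_self k)⟩
      · rintro ⟨h1, h2⟩
        refine le_antisymm h1 ?_
        have := Order.add_one_le_of_lt h2
        exact_mod_cast this
    rw [this]
    exact MeasurableSet.diff (T.measurableSet_time_le Z hkn) (T.measurableSet_time_le Z (by omega))

/-- The probability of stopping early and accepting a hypothesis is controlled through the error
probabilities and a change of measure, for which the bound `hchange` is given. -/
theorem measure_time_le [MeasurableSpace Ω] (P Q : Measure Ω) (C : ∀ k : ℕ, Set (Fin k → 𝒵))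
    (hC : ∀ k, MeasurableSet (C k)) {n : ℕ} {a b κ δ : ℝ≥0∞}
    (ha : P {ω | ∃ k : ℕ, T.time Z ω = k ∧ obs Z k ω ∉ C k} ≤ a)
    (hb : Q {ω | ∃ k : ℕ, T.time Z ω = k ∧ obs Z k ω ∈ C k} ≤ b)
    (hchange : ∀ A : Set Ω, MeasurableSet[MeasurableSpace.comap (obs Z n) inferInstance] A →
      P A ≤ κ * Q A + δ) :
    P {ω | T.time Z ω ≤ n} ≤ a + κ * b + δ := by
  -- The decision to be transferred from `Q` to `P` is cut off at time `n`, which makes it an event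
  -- of the first `n` observations, as `hchange` requires.
  set A : Set Ω := {ω | ∃ k : ℕ, k ≤ n ∧ T.time Z ω = k ∧ obs Z k ω ∈ C k} with hA
  have hAm : MeasurableSet[MeasurableSpace.comap (obs Z n) inferInstance] A := by
    have : A = ⋃ k, ⋃ (_ : k ≤ n), ({ω | T.time Z ω = k} ∩ {ω | obs Z k ω ∈ C k}) := by
      ext ω
      simp only [hA, mem_ofPred_eq, mem_iUnion, exists_prop, mem_inter_iff]
    rw [this]
    exact MeasurableSet.iUnion fun k => MeasurableSet.iUnion fun hk =>
      MeasurableSet.inter (T.measurableSet_time_eq Z hk) (measurableSet_comap_obs Z hk (hC k))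
  calc P {ω | T.time Z ω ≤ n} ≤ P ({ω | ∃ k : ℕ, T.time Z ω = k ∧ obs Z k ω ∉ C k} ∪ A) := by
        refine measure_mono fun ω hω => ?_
        have hω' : T.time Z ω ≤ n := hω
        obtain ⟨k, hk⟩ := ENat.ne_top_iff_exists.1 (ne_top_of_le_ne_top (ENat.natCast_ne_top n) hω')
        by_cases h : obs Z k ω ∈ C k
        · right
          exact ⟨k, by rw [← hk] at hω'; exact Nat.cast_le.1 hω', hk.symm, h⟩
        · left
          exact ⟨k, hk.symm, h⟩
    _ ≤ P {ω | ∃ k : ℕ, T.time Z ω = k ∧ obs Z k ω ∉ C k} + P A := measure_union_le _ _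
    _ ≤ a + (κ * Q A + δ) := add_le_add ha (hchange A hAm)
    _ ≤ a + (κ * b + δ) := by
        have hsub : A ⊆ {ω | ∃ k : ℕ, T.time Z ω = k ∧ obs Z k ω ∈ C k} := fun ω ⟨k, _, h⟩ => ⟨k, h⟩
        gcongr
        exact (measure_mono hsub).trans hb
    _ = _ := (add_assoc _ _ _).symm

end SeqTest

namespace HMMModel

variable {S 𝒵 Ω : Type*} [Fintype S] [MeasurableSpace 𝒵] [MeasurableSpace Ω] {ν : Measure 𝒵}
  {m : HMMModel S 𝒵 ν} [MeasurableSpace S] [DiscreteMeasurableSpace S] [SigmaFinite ν]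
  {P₀ P₁ : Measure Ω} [IsProbabilityMeasure P₀] {X : ℕ → Ω → S}
  {Z : ℕ → Ω → 𝒵}

theorem signal_apply_eq (h₀ : m.IsNoise P₀ Z) (h₁ : m.IsSignal P₁ X Z)
    (hC : m.StationaryErgodicChain) (hF₀ : m.FiniteLogMoment P₀ Z) (hF₁ : m.FiniteLogMoment P₁ Z)
    (n : ℕ) {B : Set (Fin n → 𝒵)} (hB : MeasurableSet B) :
    P₁ (obs Z n ⁻¹' B) =
      ∫⁻ ω in obs Z n ⁻¹' B, ENNReal.ofReal (Real.exp (m.logLR (obs Z n ω))) ∂P₀ := by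
  have hm := measurable_obs h₀.1 n
  have h := lintegral_signal_eq h₀ h₁ hC hF₁ n (measurable_one.indicator hB)
  have e : ∀ ω, B.indicator (1 : (Fin n → 𝒵) → ℝ≥0∞) (obs Z n ω) =
      (obs Z n ⁻¹' B).indicator 1 ω := fun ω => rfl
  simp_rw [e] at h
  rw [lintegral_indicator_one (hm hB)] at h
  rw [h, ← lintegral_indicator (hm hB)]
  refine lintegral_congr_ae ?_
  filter_upwards [hF₀.ae_all_mem h₀.isErgodicSequence] with ω hω
  have := m.likelihoodRatio_eq_exp (z := fun i => Z i ω) hω n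
  by_cases hωB : ω ∈ obs Z n ⁻¹' B
  · rw [indicator_of_mem hωB, indicator_of_mem hωB, Pi.one_apply, mul_one]
    exact this
  · rw [indicator_of_notMem hωB, indicator_of_notMem hωB, mul_zero]

/-- Where `logLR ≥ -c` the density of `P₁` with respect to `P₀` is at least `exp (-c)`; the
exceptional set is paid for separately. -/
theorem noise_le_signal (h₀ : m.IsNoise P₀ Z) (h₁ : m.IsSignal P₁ X Z)
    (hC : m.StationaryErgodicChain) (hF₀ : m.FiniteLogMoment P₀ Z) (hF₁ : m.FiniteLogMoment P₁ Z)
    (n : ℕ) (c : ℝ) (A : Set Ω)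
    (hA : MeasurableSet[MeasurableSpace.comap (obs Z n) inferInstance] A) :
    P₀ A ≤ ENNReal.ofReal (Real.exp c) * P₁ A + P₀ {ω | m.logLR (obs Z n ω) < -c} := by
  obtain ⟨B, hB, rfl⟩ := hA
  have hm := measurable_obs h₀.1 n
  set G : Set (Fin n → 𝒵) := {z | -c ≤ m.logLR z}
  have hG : MeasurableSet G := measurableSet_le measurable_const (m.measurable_logLR n)
  calc P₀ (obs Z n ⁻¹' B) ≤ P₀ (obs Z n ⁻¹' (B ∩ G) ∪ {ω | m.logLR (obs Z n ω) < -c}) := by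
        refine measure_mono fun ω hω => ?_
        rcases lt_or_ge (m.logLR (obs Z n ω)) (-c) with h | h
        · exact Or.inr h
        · exact Or.inl ⟨hω, h⟩
    _ ≤ P₀ (obs Z n ⁻¹' (B ∩ G)) + P₀ {ω | m.logLR (obs Z n ω) < -c} := measure_union_le _ _
    _ ≤ _ := by
        gcongr
        calc P₀ (obs Z n ⁻¹' (B ∩ G)) = ∫⁻ ω in obs Z n ⁻¹' (B ∩ G), 1 ∂P₀ := by simp
          _ ≤ ∫⁻ ω in obs Z n ⁻¹' (B ∩ G), ENNReal.ofReal (Real.exp c) *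
              ENNReal.ofReal (Real.exp (m.logLR (obs Z n ω))) ∂P₀ := by
              refine setLIntegral_mono' (hm (hB.inter hG)) fun ω hω => ?_
              rw [← ENNReal.ofReal_mul (Real.exp_pos _).le, ← Real.exp_add, ENNReal.one_le_ofReal,
                Real.one_le_exp_iff]
              have : -c ≤ m.logLR (obs Z n ω) := hω.2
              linarith
          _ = ENNReal.ofReal (Real.exp c) * P₁ (obs Z n ⁻¹' (B ∩ G)) := by
              rw [lintegral_const_mul' _ _ ENNReal.ofReal_ne_top,
                signal_apply_eq h₀ h₁ hC hF₀ hF₁ n (hB.inter hG)]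
          _ ≤ _ := by
              gcongr
              exact inter_subset_left

/-- Where `logLR ≤ c` the density of `P₁` with respect to `P₀` is at most `exp c`. -/
theorem signal_le_noise (h₀ : m.IsNoise P₀ Z) (h₁ : m.IsSignal P₁ X Z)
    (hC : m.StationaryErgodicChain) (hF₀ : m.FiniteLogMoment P₀ Z) (hF₁ : m.FiniteLogMoment P₁ Z)
    (n : ℕ) (c : ℝ) (A : Set Ω)
    (hA : MeasurableSet[MeasurableSpace.comap (obs Z n) inferInstance] A) :
    P₁ A ≤ ENNReal.ofReal (Real.exp c) * P₀ A + P₁ {ω | c < m.logLR (obs Z n ω)} := by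
  obtain ⟨B, hB, rfl⟩ := hA
  have hm := measurable_obs h₀.1 n
  set G : Set (Fin n → 𝒵) := {z | m.logLR z ≤ c}
  have hG : MeasurableSet G := measurableSet_le (m.measurable_logLR n) measurable_const
  calc P₁ (obs Z n ⁻¹' B) ≤ P₁ (obs Z n ⁻¹' (B ∩ G) ∪ {ω | c < m.logLR (obs Z n ω)}) := by
        refine measure_mono fun ω hω => ?_
        rcases lt_or_ge c (m.logLR (obs Z n ω)) with h | h
        · exact Or.inr h
        · exact Or.inl ⟨hω, h⟩
    _ ≤ P₁ (obs Z n ⁻¹' (B ∩ G)) + P₁ {ω | c < m.logLR (obs Z n ω)} := measure_union_le _ _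
    _ ≤ _ := by
        gcongr
        rw [signal_apply_eq h₀ h₁ hC hF₀ hF₁ n (hB.inter hG)]
        calc _ ≤ ∫⁻ ω in obs Z n ⁻¹' (B ∩ G), ENNReal.ofReal (Real.exp c) ∂P₀ := by
              refine setLIntegral_mono' (hm (hB.inter hG)) fun ω hω => ?_
              exact ENNReal.ofReal_le_ofReal (Real.exp_le_exp.2 hω.2)
          _ = ENNReal.ofReal (Real.exp c) * P₀ (obs Z n ⁻¹' (B ∩ G)) := by simp
          _ ≤ _ := by
              gcongr
              exact inter_subset_left

end HMMModel

/-! ### Asymptotic lower bounds of the moments -/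

theorem eventually_errorBoundsToZero :
    ∀ᶠ p in errorBoundsToZero, p.1 ∈ Ioo (0 : ℝ) 1 ∧ p.2 ∈ Ioo (0 : ℝ) 1 := by
  refine Filter.mem_inf_of_right ?_
  rw [mem_principal]
  exact fun p hp => ⟨hp.1, hp.2⟩

theorem tendsto_add_errorBoundsToZero :
    Tendsto (fun p : ℝ × ℝ => p.1 + p.2) errorBoundsToZero (𝓝 0) :=
  tendsto_comap.mono_left inf_le_left

theorem tendsto_fst_errorBoundsToZero :
    Tendsto (fun p : ℝ × ℝ => p.1) errorBoundsToZero (𝓝[>] 0) := by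
  refine tendsto_nhdsWithin_iff.2 ⟨?_, eventually_errorBoundsToZero.mono fun p hp => hp.1.1⟩
  exact tendsto_of_tendsto_of_tendsto_of_le_of_le' tendsto_const_nhds tendsto_add_errorBoundsToZero
    (eventually_errorBoundsToZero.mono fun p hp => hp.1.1.le)
    (eventually_errorBoundsToZero.mono fun p hp => by linarith [hp.2.1])

theorem tendsto_snd_errorBoundsToZero :
    Tendsto (fun p : ℝ × ℝ => p.2) errorBoundsToZero (𝓝[>] 0) := by
  refine tendsto_nhdsWithin_iff.2 ⟨?_, eventually_errorBoundsToZero.mono fun p hp => hp.2.1⟩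
  exact tendsto_of_tendsto_of_tendsto_of_le_of_le' tendsto_const_nhds tendsto_add_errorBoundsToZero
    (eventually_errorBoundsToZero.mono fun p hp => hp.2.1.le)
    (eventually_errorBoundsToZero.mono fun p hp => by linarith [hp.1.1])

/-- An asymptotic lower bound of the moments of a family of random times of which it is unlikely
that they are small in comparison with `|ln b|`. -/
theorem le_liminf_moment {Ω ι : Type*} [MeasurableSpace Ω] {P : Measure Ω} [IsProbabilityMeasure P]
    {F : Filter ι} {a b : ι → ℝ} (ha : Tendsto a F (𝓝 0)) (hb : Tendsto b F (𝓝[>] 0))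
    {τ : ι → Ω → ℕ∞} (hτ : ∀ i (n : ℕ), MeasurableSet {ω | τ i ω ≤ n}) {l r : ℝ} (hl : 0 < l)
    (hr : 0 < r) {δ : ℝ → ℕ → ℝ≥0∞} (hδ : ∀ s, l < s → Tendsto (δ s) atTop (𝓝 0))
    (hP : ∀ᶠ i in F, ∀ (s : ℝ) (n : ℕ), P {ω | τ i ω ≤ n} ≤
      ENNReal.ofReal (a i) + ENNReal.ofReal (Real.exp (s * n)) * ENNReal.ofReal (b i) + δ s n) :
    ENNReal.ofReal (1 / l ^ r) ≤ liminf (fun i => (∫⁻ ω, ((τ i ω : ℕ∞) : ℝ≥0∞) ^ r ∂P) /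
      ENNReal.ofReal (|Real.log (b i)| ^ r)) F := by
  have hlogb : Tendsto (fun i => Real.log (b i)) F atBot := Real.tendsto_log_nhdsGT_zero.comp hb
  have hlog : Tendsto (fun i => |Real.log (b i)|) F atTop := tendsto_abs_atBot_atTop.comp hlogb
  have hbpos : ∀ᶠ i in F, 0 < b i := (tendsto_nhdsWithin_iff.1 hb).2
  suffices h : ∀ t, l < t → ENNReal.ofReal (1 / t ^ r) ≤
      liminf (fun i => (∫⁻ ω, ((τ i ω : ℕ∞) : ℝ≥0∞) ^ r ∂P) /
        ENNReal.ofReal (|Real.log (b i)| ^ r)) F by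
    have hcont : Tendsto (fun t : ℝ => ENNReal.ofReal (1 / t ^ r)) (𝓝[>] l)
        (𝓝 (ENNReal.ofReal (1 / l ^ r))) := by
      refine ENNReal.tendsto_ofReal (Tendsto.mono_left ?_ nhdsWithin_le_nhds)
      exact tendsto_const_nhds.div (Real.continuousAt_rpow_const l r (Or.inl hl.ne')).tendsto
        (Real.rpow_pos_of_pos hl r).ne'
    exact le_of_tendsto hcont (eventually_mem_nhdsWithin.mono fun t ht => h t ht)
  intro t ht
  have ht0 : 0 < t := hl.trans ht
  -- The gap `s > l` makes `δ s` vanish, and the gap `s < t` lets the small `b` beat the factor `exp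
  -- (s n)`.
  obtain ⟨s, hs, hst⟩ := exists_between ht
  have hs0 : 0 < s := hl.trans hs
  -- For this `n` the product `exp (s n) * b` is at most `b ^ (1 - s / t)` once `b < 1`, while `n +
  -- 1` still exceeds `|ln b| / t`.
  set n : ι → ℕ := fun i => ⌊|Real.log (b i)| / t⌋₊ with hn
  set η : ι → ℝ≥0∞ := fun i => ENNReal.ofReal (a i) +
    ENNReal.ofReal (Real.exp (s * n i)) * ENNReal.ofReal (b i) + δ s (n i) with hη
  have hn_tendsto : Tendsto n F atTop := tendsto_nat_floor_atTop.comp (hlog.atTop_div_const ht0)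
  have h2 : Tendsto (fun i => ENNReal.ofReal (Real.exp (s * n i)) * ENNReal.ofReal (b i)) F (𝓝 0) := by
    have hlim : Tendsto (fun i => ENNReal.ofReal (Real.exp ((s / t - 1) * |Real.log (b i)|))) F (𝓝 0) := by
      rw [← ENNReal.ofReal_zero]
      refine ENNReal.tendsto_ofReal (Real.tendsto_exp_atBot.comp ?_)
      refine hlog.const_mul_atTop_of_neg ?_
      rw [sub_neg, div_lt_one ht0]
      exact hst
    refine tendsto_of_tendsto_of_tendsto_of_le_of_le' tendsto_const_nhds hlim
      (Eventually.of_forall fun _ => zero_le) ?_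
    filter_upwards [hbpos, hlogb.eventually_lt_atBot 0] with i hi hi'
    rw [← ENNReal.ofReal_mul (Real.exp_pos _).le]
    refine ENNReal.ofReal_le_ofReal ?_
    rw [← Real.exp_log hi, ← Real.exp_add, Real.log_exp, Real.exp_le_exp]
    have h3 : (n i : ℝ) ≤ |Real.log (b i)| / t := Nat.floor_le (by positivity)
    have h4 : s * n i ≤ s / t * |Real.log (b i)| := by
      calc s * n i ≤ s * (|Real.log (b i)| / t) := by gcongr
        _ = _ := by ring
    rw [abs_of_neg hi'] at *
    linarith
  have hη0 : Tendsto η F (𝓝 0) := by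
    have := ((ENNReal.tendsto_ofReal ha).add h2).add ((hδ s hs).comp hn_tendsto)
    simpa using this
  have hlim : Tendsto (fun i => (1 - η i) * ENNReal.ofReal (1 / t ^ r)) F
      (𝓝 (ENNReal.ofReal (1 / t ^ r))) := by
    have h1 : Tendsto (fun i => 1 - η i) F (𝓝 (1 - 0)) :=
      ENNReal.Tendsto.sub tendsto_const_nhds hη0 (Or.inl ENNReal.one_ne_top)
    rw [tsub_zero] at h1
    have := ENNReal.Tendsto.mul_const (b := ENNReal.ofReal (1 / t ^ r)) h1
      (Or.inr ENNReal.ofReal_ne_top)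
    rwa [one_mul] at this
  refine le_of_forall_lt fun x hx => ?_
  obtain ⟨y, hxy, hy⟩ := exists_between hx
  refine hxy.trans_le (le_liminf_of_le (by isBoundedDefault) ?_)
  filter_upwards [hlim.eventually_const_lt hy, hP, hlog.eventually_gt_atTop 0] with i hi hPi hpos
  refine hi.le.trans ?_
  have hpr : 0 < |Real.log (b i)| ^ r := Real.rpow_pos_of_pos hpos r
  rw [ENNReal.le_div_iff_mul_le (Or.inl (by simpa using hpr)) (Or.inl ENNReal.ofReal_ne_top),
    mul_assoc, ← ENNReal.ofReal_mul (by positivity)]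
  have hmeas : MeasurableSet {ω | τ i ω ≤ n i}ᶜ := (hτ i (n i)).compl
  have hprob : 1 - η i ≤ P {ω | τ i ω ≤ n i}ᶜ := by
    rw [prob_compl_eq_one_sub (hτ i (n i))]
    exact tsub_le_tsub_left (hPi s (n i)) 1
  have hle : ENNReal.ofReal (1 / t ^ r * |Real.log (b i)| ^ r) ≤ ((n i + 1 : ℕ) : ℝ≥0∞) ^ r := by
    have e1 : 1 / t ^ r * |Real.log (b i)| ^ r = (|Real.log (b i)| / t) ^ r := by
      rw [Real.div_rpow hpos.le ht0.le]; ring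
    rw [e1, ← ENNReal.ofReal_rpow_of_nonneg (by positivity) hr.le]
    refine ENNReal.rpow_le_rpow ?_ hr.le
    rw [← ENNReal.ofReal_natCast]
    refine ENNReal.ofReal_le_ofReal ?_
    push_cast
    exact (Nat.lt_floor_add_one _).le
  -- Off the event `τ ≤ n` the time is at least `n + 1`; outcomes where the test never stops, with
  -- value `⊤`, are included.
  calc (1 - η i) * ENNReal.ofReal (1 / t ^ r * |Real.log (b i)| ^ r)
      ≤ P {ω | τ i ω ≤ n i}ᶜ * ((n i + 1 : ℕ) : ℝ≥0∞) ^ r := by gcongr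
    _ = ∫⁻ ω, ({ω | τ i ω ≤ n i}ᶜ).indicator (fun _ => ((n i + 1 : ℕ) : ℝ≥0∞) ^ r) ω ∂P := by
        rw [lintegral_indicator_const hmeas, mul_comm]
    _ ≤ _ := by
        refine lintegral_mono fun ω => indicator_le (s := {ω | τ i ω ≤ n i}ᶜ)
          (f := fun _ => ((n i + 1 : ℕ) : ℝ≥0∞) ^ r)
          (g := fun ω => ((τ i ω : ℕ∞) : ℝ≥0∞) ^ r) (fun ω hω => ?_) ω
        refine ENNReal.rpow_le_rpow ?_ hr.le
        have h5 : (n i : ℕ∞) < τ i ω := not_le.1 hω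
        have h6 : ((n i + 1 : ℕ) : ℕ∞) ≤ τ i ω := by
          have := Order.add_one_le_of_lt h5
          exact_mod_cast this
        exact_mod_cast ENat.toENNReal_mono h6

/-- The lower bounds of the moments of the stopping times of tests with small error probabilities. -/
theorem HMMModel.le_liminf_moment_of_tests {S 𝒵 Ω : Type*} [Fintype S] [MeasurableSpace S]
    [DiscreteMeasurableSpace S] [MeasurableSpace 𝒵] [MeasurableSpace Ω] {ν : Measure 𝒵}
    [SigmaFinite ν] {m : HMMModel S 𝒵 ν} {P₀ P₁ : Measure Ω} [IsProbabilityMeasure P₀]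
    [IsProbabilityMeasure P₁] {X : ℕ → Ω → S} {Z : ℕ → Ω → 𝒵} (hH₀ : m.IsNoise P₀ Z)
    (hH₁ : m.IsSignal P₁ X Z) (hC : m.StationaryErgodicChain) (hF₀ : m.FiniteLogMoment P₀ Z)
    (hF₁ : m.FiniteLogMoment P₁ Z) {l₀ l₁ : ℝ} (hneg : l₀ < 0) (hpos : 0 < l₁)
    (hi₀ : ∀ n, Integrable (fun ω => m.logLR (obs Z n ω)) P₀)
    (hi₁ : ∀ n, Integrable (fun ω => m.logLR (obs Z n ω)) P₁)
    (hL₀ : Tendsto (fun n : ℕ => ∫ ω, |m.logLR (obs Z n ω) / (n : ℝ) - l₀| ∂P₀) atTop (𝓝 0))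
    (hL₁ : Tendsto (fun n : ℕ => ∫ ω, |m.logLR (obs Z n ω) / (n : ℝ) - l₁| ∂P₁) atTop (𝓝 0))
    (T : ℝ × ℝ → SeqTest 𝒵) (hT : ∀ p : ℝ × ℝ, p.1 ∈ Ioo (0 : ℝ) 1 → p.2 ∈ Ioo (0 : ℝ) 1 →
      T p ∈ testClass Z P₀ P₁ p.1 p.2) {r : ℝ} (hr : 0 < r) :
    ENNReal.ofReal (1 / |l₀| ^ r) ≤ liminf (fun p : ℝ × ℝ => (T p).moment Z P₀ r /
        ENNReal.ofReal (|Real.log p.2| ^ r)) errorBoundsToZero ∧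
      ENNReal.ofReal (1 / l₁ ^ r) ≤ liminf (fun p : ℝ × ℝ => (T p).moment Z P₁ r /
        ENNReal.ofReal (|Real.log p.1| ^ r)) errorBoundsToZero := by
  have hm := fun n => measurable_obs hH₀.1 n
  have hτ : ∀ (p : ℝ × ℝ) (n : ℕ),
      MeasurableSet {ω | (T p).time Z ω ≤ n} := fun p n =>
    (hm n).comap_le _ ((T p).measurableSet_time_le Z le_rfl)
  constructor
  -- Under `P₀` accepting `H₁` is an error and enters directly through `α`; accepting `H₀` is an
  -- error under `P₁` and enters through `β` after the change of measure, hence the normalization by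
  -- `ln β`.
  · refine le_liminf_moment (P := P₀) (F := errorBoundsToZero) (a := fun p => p.1) (b := fun p => p.2)
      (τ := fun p ω => (T p).time Z ω)
      (tendsto_nhds_of_tendsto_nhdsWithin tendsto_fst_errorBoundsToZero)
      tendsto_snd_errorBoundsToZero hτ (abs_pos.2 hneg.ne) hr
      (δ := fun s n => P₀ {ω | m.logLR (obs Z n ω) < -(s * n)}) (fun s hs => ?_) ?_
    · rw [abs_of_neg hneg] at hs
      refine tendsto_of_tendsto_of_tendsto_of_le_of_le' tendsto_const_nhds
        (tendsto_measure_abs_sub_ge hi₀ hL₀ (show 0 < s + l₀ by linarith))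
        (Eventually.of_forall fun _ => zero_le) ((eventually_gt_atTop 0).mono fun n hn => ?_)
      refine measure_mono fun ω (hω : m.logLR (obs Z n ω) < -(s * n)) => ?_
      have hn' : (0 : ℝ) < n := Nat.cast_pos.2 hn
      have h1 : m.logLR (obs Z n ω) / n < -s := by
        rw [div_lt_iff₀ hn']; linarith
      exact (by linarith : s + l₀ ≤ -(m.logLR (obs Z n ω) / n - l₀)).trans (neg_le_abs _)
    · filter_upwards [eventually_errorBoundsToZero] with p hp s n
      have hTp := hT p hp.1 hp.2
      refine SeqTest.measure_time_le _ Z P₀ P₁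
        (fun k => ((T p).acceptSet k)ᶜ)
        (fun k => (SeqTest.measurableSet_acceptSet _ k).compl) ?_ hTp.2
        (HMMModel.noise_le_signal hH₀ hH₁ hC hF₀ hF₁ n (s * n))
      simp only [mem_compl_iff, not_not]
      exact hTp.1
  · refine le_liminf_moment (P := P₁) (F := errorBoundsToZero) (a := fun p => p.2) (b := fun p => p.1)
      (τ := fun p ω => (T p).time Z ω)
      (tendsto_nhds_of_tendsto_nhdsWithin tendsto_snd_errorBoundsToZero)
      tendsto_fst_errorBoundsToZero hτ hpos hr
      (δ := fun s n => P₁ {ω | s * n < m.logLR (obs Z n ω)}) (fun s hs => ?_) ?_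
    · refine tendsto_of_tendsto_of_tendsto_of_le_of_le' tendsto_const_nhds
        (tendsto_measure_abs_sub_ge hi₁ hL₁ (show 0 < s - l₁ by linarith))
        (Eventually.of_forall fun _ => zero_le) ((eventually_gt_atTop 0).mono fun n hn => ?_)
      refine measure_mono fun ω (hω : s * n < m.logLR (obs Z n ω)) => ?_
      have hn' : (0 : ℝ) < n := Nat.cast_pos.2 hn
      have h1 : s < m.logLR (obs Z n ω) / n := by
        rw [lt_div_iff₀ hn']; exact hω
      exact (by linarith : s - l₁ ≤ m.logLR (obs Z n ω) / n - l₁).trans (le_abs_self _)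
    · filter_upwards [eventually_errorBoundsToZero] with p hp s n
      have hTp := hT p hp.1 hp.2
      exact SeqTest.measure_time_le _ Z P₁ P₀
        (fun k => (T p).acceptSet k)
        (fun k => SeqTest.measurableSet_acceptSet _ k) hTp.2 hTp.1
        (HMMModel.signal_le_noise hH₀ hH₁ hC hF₀ hF₁ n (s * n))

theorem theorem3 {S 𝒵 Ω : Type*} [Fintype S] [MeasurableSpace S] [DiscreteMeasurableSpace S]
    [MeasurableSpace 𝒵] [MeasurableSpace Ω] (ν : Measure 𝒵) [SigmaFinite ν]
    (m : HMMModel S 𝒵 ν)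
    (P₀ P₁ : Measure Ω) [IsProbabilityMeasure P₀] [IsProbabilityMeasure P₁]
    (X : ℕ → Ω → S) (Z : ℕ → Ω → 𝒵)
    (hH₀ : m.IsNoise P₀ Z) (hH₁ : m.IsSignal P₁ X Z)
    (hC₁ : m.StationaryErgodicChain) (hC₂ : m.NoiseNotMixture)
    (hC₃ : m.FiniteLogMoment P₀ Z ∧ m.FiniteLogMoment P₁ Z) :
    ∃ l₀ l₁ : ℝ, m.IsLogLikelihoodRate P₀ Z l₀ ∧ m.IsLogLikelihoodRate P₁ Z l₁ ∧
      l₀ < 0 ∧ 0 < l₁ ∧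
      ∀ γ₀ γ₁ : ℝ → ℝ → ℝ,
        (∀ α ∈ Ioo (0 : ℝ) 1, ∀ β ∈ Ioo (0 : ℝ) 1,
          0 < γ₀ α β ∧ γ₀ α β < 1 ∧ 1 < γ₁ α β ∧
            m.sprt (γ₀ α β) (γ₁ α β) ∈ testClass Z P₀ P₁ α β) →
        ∀ r : ℝ, 0 < r →
          ENNReal.ofReal (1 / |l₀| ^ r) ≤
            liminf (fun p : ℝ × ℝ =>
              (m.sprt (γ₀ p.1 p.2) (γ₁ p.1 p.2)).moment Z P₀ r /
                ENNReal.ofReal (|Real.log p.2| ^ r)) errorBoundsToZero ∧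
          ENNReal.ofReal (1 / l₁ ^ r) ≤
            liminf (fun p : ℝ × ℝ =>
              (m.sprt (γ₀ p.1 p.2) (γ₁ p.1 p.2)).moment Z P₁ r /
                ENNReal.ofReal (|Real.log p.1| ^ r)) errorBoundsToZero := by
  obtain ⟨hF₀, hF₁⟩ := hC₃
  obtain ⟨l₀, hl₀, hL₀⟩ := HMMModel.exists_isLogLikelihoodRate hH₀.isErgodicSequence hC₁ hF₀
  obtain ⟨l₁, hl₁, hL₁⟩ := HMMModel.exists_isLogLikelihoodRate (hH₁.isErgodicSequence hC₁) hC₁ hF₁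
  obtain ⟨hneg, hpos⟩ := HMMModel.rate_neg_and_rate_pos hH₀ hH₁ hC₁ hC₂ hF₀ hF₁ hl₀ hl₁
  refine ⟨l₀, l₁, hl₀, hl₁, hneg, hpos, fun γ₀ γ₁ hγ r hr => ?_⟩
  exact HMMModel.le_liminf_moment_of_tests hH₀ hH₁ hC₁ hF₀ hF₁ hneg hpos hl₀.1 hl₁.1 hL₀ hL₁
    (fun p => m.sprt (γ₀ p.1 p.2) (γ₁ p.1 p.2)) (fun p h₁ h₂ => (hγ p.1 h₁ p.2 h₂).2.2.2) hr
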